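/- Let $\Sigma$ be a set of labels with a distinguished element $\tau$ and an involution $a\mapsto\overline a$ on $\Sigma\setminus\{\tau\}$. **Labelled symmetric precubical sets.** Let $[n]=\{0,1\}^n$ with the product order. Let $\square_S$ be the category with objects $[n]$, $n\ge 0$, whose morphisms are the one-to-one, strictly increasing maps preserving pairs of vertices at Hamming distance $1$ (equivalently, the composites of face maps and symmetry maps). Let $!^S\Sigma$ be the presheaf on $\square_S$ with $(!^S\Sigma)_n=\Sigma^n$, on which face maps act by deleting a letter and symmetry maps by exchanging two adjacent letters. A labelled symmetric precubical set is a presheaf $K$ on $\square_S$ with a map $\ell:K\to{!^S\Sigma}$. Write $\square_S[a_1,\dots,a_n]$ for the representable presheaf $\square_S(-,[n])$ with labelling $f\mapsto f^*(a_1,\dots,a_n)$, $\partial\square_S[a_1,\dots,a_n]$ for its subobject of cubes of dimension $<n$, and $K_{\le 1}$ for the cubes of dimension $\le 1$ of $K$. $K$ satisfies the *HDA paradigm* if for all $p\ge 2$ and $a_1,\dots,a_p\in\Sigma$, every map $\partial\square_S[a_1,\dots,a_p]\to K$ has at most one extension to $\square_S[a_1,\dots,a_p]$. **Transition systems.** A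 *weak higher dimensional transition system* consists of a set $S$ of states, a set $L$ of actions, a map $\mu:L\to\Sigma$ and sets $T_n\subset S\times L^n\times S$ ($n\ge 1$) of transitions such that: (Multiset) transitions are stable under permutation of $u_1,\dots,u_n$; (Coherence) for $p,q\ge 1$ and $p+q<n$, if $(\alpha,u_1,\dots,u_n,\beta)$, $(\alpha,u_1,\dots,u_p,\nu_1)$, $(\nu_1,u_{p+1},\dots,u_n,\beta)$, $(\alpha,u_1,\dots,u_{p+q},\nu_2)$ and $(\nu_2,u_{p+q+1},\dots,u_n,\beta)$ are transitions, so is $(\nu_1,u_{p+1},\dots,u_{p+q},\nu_2)$. Consider the axioms: * CSA1: if $(\alpha,u,\beta)$ and $(\alpha,u',\beta)$ are transitions with $\mu(u)=\mu(u')$, then $u=u'$. * Unique intermediate state: for every transition $(\alpha,u_1,\dots,u_n,\beta)$ and $1\le p<n$ there is exactly one state $\nu$ such that $(\alpha,u_1,\dots,u_p,\nu)$ and $(\nu,u_{p+1},\dots,u_n,\beta)$ are transitions. * CSA2: for every transition $(\alpha,u_1,\dots,u_n,\beta)$ and $1\le p<n$ there are a unique $\nu_1$ and a unique $\nu_2$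 such that $(\alpha,u_1,\dots,u_p,\nu_1)$, $(\nu_1,u_{p+1},\dots,u_n,\beta)$, $(\alpha,u_{p+1},\dots,u_n,\nu_2)$ and $(\nu_2,u_1,\dots,u_p,\beta)$ are transitions. * CSA3: for $p,q\ge1$, $p+q<n$, if $(\alpha,u_1,\dots,u_n,\beta)$, $(\alpha,u_1,\dots,u_p,\nu_1)$, $(\nu_1,u_{p+1},\dots,u_n,\beta)$, $(\nu_1,u_{p+1},\dots,u_{p+q},\nu_2)$, $(\nu_2,u_{p+q+1},\dots,u_n,\beta)$, $(\alpha,u_1,\dots,u_{p+q},\nu_2')$, $(\nu_2',u_{p+q+1},\dots,u_n,\beta)$, $(\alpha,u_1,\dots,u_p,\nu_1')$ and $(\nu_1',u_{p+1},\dots,u_{p+q},\nu_2')$ are transitions, then $\nu_1=\nu_1'$ and $\nu_2=\nu_2'$. A *higher dimensional transition system* satisfies the Multiset axiom, CSA1, CSA2 and CSA3. The cube $C_n[a_1,\dots,a_n]$ has the set of states $[n]$, the actions $(a_1,1),\dots,(a_n,n)$ with $\mu(a_i,i)=a_i$, and the transitions $(\epsilon,(a_{i_1},i_1),\dots,(a_{i_d},i_d),\epsilon')$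 with $d\ge 1$, distinct $i_1,\dots,i_d$, $\epsilon\le\epsilon'$, and $\epsilon_i\ne\epsilon'_i$ exactly for $i\in\{i_1,\dots,i_d\}$. The realization of $K$ is $$\mathbb T(K)=\varinjlim_{\square_S[a_1,\dots,a_n]\to K}C_n[a_1,\dots,a_n],$$ the colimit being taken in the category of weak higher dimensional transition systems (maps act on states and on actions, and preserve labels and transitions). **CCS.** The process names are the closed terms of the grammar $$P::=nil\mid a.P\mid(\nu b)P\mid P+P\mid P\,||\,P\mid x\mid\mathrm{rec}(x)P\qquad(a\in\Sigma,\ b\in\Sigma\setminus\{\tau\})$$ in which, in every subterm $\mathrm{rec}(x)P$, each free occurrence of $x$ in $P$ lies inside a prefix term. Each process name $P$ is interpreted, by induction, as a labelled symmetric precubical set $\square_S[\![P]\!]$ with an initial state: * $\square_S[\![nil]\!]=\square_S[0]$ is a point; * $\square_S[\![a.P]\!]$ is $\square_S[a]$ with its final state glued to the initial state of $\square_S[\![P]\!]$, the initial state being that of $\square_S[a]$; * $\square_S[\![P+Q]\!]$ is obtained from the disjoint union by gluing the two initial states; * $\square_S[\![(\nu b)P]\!]$ consists of the cubes of $\square_S[\![P]\!]$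 none of whose labels is $b$ or $\overline b$; * $\square_S[\![P||Q]\!]=\square_S[\![P]\!]\otimes_\Sigma\square_S[\![Q]\!]$, with initial state the pair of the initial states, where $$K\otimes_\Sigma L=\varinjlim_{\square_S[a_1,\dots,a_m]\to K}\ \varinjlim_{\square_S[b_1,\dots,b_n]\to L}\mathrm{COSK}\bigl(\square_S[a_1,\dots,a_m]_{\le1}\times_\Sigma\square_S[b_1,\dots,b_n]_{\le1}\bigr);$$ * $\square_S[\![\mathrm{rec}(x)P(x)]\!]=\varinjlim_k\square_S[\![P^k(nil)]\!]$, the transition maps being induced from the inclusion of the initial state $\square_S[\![nil]\!]\to\square_S[\![P(nil)]\!]$ (for this, terms with free variables are interpreted as functors of the interpretations of their variables). Here, for $G$ and $H$ of dimension at most $1$, $G\times_\Sigma H$ has the set of vertices $G_0\times H_0$ and the set of edges $(G_1\times H_0)\sqcup(G_0\times H_1)\sqcup\{(x,y)\in G_1\times H_1:\ell(x)\neq\tau,\ \overline{\ell(x)}=\ell(y)\}$ with the componentwise faces; edges of the first two kinds keep their labels and those of the third kind are labelled by $\tau$. For $G$ of dimension at most $1$ with $G_0=[p]$, the $n$-cubes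 of $\mathrm{COSK}(G)$ labelled by $(a_1,\dots,a_n)$ are the labelled maps $\square_S[a_1,\dots,a_n]_{\le1}\to G$ which, if $n\ge2$, are non-twisted: the map $[n]\to[p]$ on vertices is a composite of a map $(\epsilon_1,\dots,\epsilon_n)\mapsto(\epsilon_{i_1},\dots,\epsilon_{i_q})$ with $\{i_1,\dots,i_q\}=\{1,\dots,n\}$ followed by a composite of face maps $[q]\to[p]$. **Theorem.** For every CCS process name $P$, the labelled symmetric precubical set $\square_S[\![P]\!]$ satisfies the HDA paradigm, and the weak higher dimensional transition system $\mathbb T(\square_S[\![P]\!])$ satisfies CSA1 and the Unique intermediate state axiom; hence $\mathbb T(\square_S[\![P]\!])$ is a higher dimensional transition system. -/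

import Mathlib

open CategoryTheory

universe u

namespace CCS

/-! ## The category of cubes -/

/-- The set `[n] = {0,1}^n` of vertices of the `n`-cube, with the product order. -/
abbrev Vtx (n : ℕ) : Type := Fin n → Bool

/-- A morphism `[m] → [n]` of the category `□_S`: a one-to-one adjacency-preserving map, i.e. a
one-to-one strictly increasing map which preserves the pairs of vertices at (Hamming) distance
one. -/
structure BoxHom (m n : ℕ) : Type where
  toFun : Vtx m → Vtx n
  strictMono : StrictMono toFun
  adj : ∀ x y : Vtx m, hammingDist x y = 1 → hammingDist (toFun x) (toFun y) = 1
  inj : Function.Injective toFun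

namespace BoxHom

instance (m n : ℕ) : CoeFun (BoxHom m n) (fun _ => Vtx m → Vtx n) := ⟨BoxHom.toFun⟩

@[ext] theorem ext {m n : ℕ} {f g : BoxHom m n} (h : ∀ x, f x = g x) : f = g := by
  cases f; cases g; congr; exact funext h

def id (n : ℕ) : BoxHom n n := ⟨fun x => x, strictMono_id, fun _ _ h => h, fun _ _ h => h⟩

/-- Composition, in the order of functions: `g.comp f = g ∘ f`. -/
def comp {m n p : ℕ} (g : BoxHom n p) (f : BoxHom m n) : BoxHom m p :=
  ⟨fun x => g (f x), g.strictMono.comp f.strictMono, fun x y h => g.adj _ _ (f.adj x y h),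
    g.inj.comp f.inj⟩

@[simp] theorem id_apply (n : ℕ) (x : Vtx n) : BoxHom.id n x = x := rfl

@[simp] theorem comp_apply {m n p : ℕ} (g : BoxHom n p) (f : BoxHom m n) (x : Vtx m) :
    g.comp f x = g (f x) := rfl

/-- The map `[0] → [n]` picking a vertex of the `n`-cube. -/
def vertex {n : ℕ} (v : Vtx n) : BoxHom 0 n where
  toFun _ := v
  strictMono x y h := absurd (Subsingleton.elim x y) h.ne
  adj x y h := by rw [Subsingleton.elim x y, hammingDist_self] at h; exact absurd h (by decide)
  inj x y _ := Subsingleton.elim x y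

theorem dim_le {m n : ℕ} (f : BoxHom m n) : m ≤ n := by
  have h := Fintype.card_le_of_injective f f.inj
  simp only [Vtx, Fintype.card_fun, Fintype.card_bool, Fintype.card_fin] at h
  exact (Nat.pow_le_pow_iff_right (by norm_num)).1 h

theorem dist_update {n : ℕ} (x : Vtx n) (i : Fin n) (h : x i = false) :
    hammingDist x (Function.update x i true) = 1 := by
  rw [hammingDist, Finset.card_eq_one]
  refine ⟨i, Finset.ext fun j => ?_⟩
  by_cases hj : j = i
  · subst hj; simp [h]
  · simp [hj]

theorem lt_update {n : ℕ} (x : Vtx n) (i : Fin n) (h : x i = false) :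
    x < Function.update x i true := by
  rw [lt_update_self_iff, h]; decide

theorem exists_dir_at {m n : ℕ} (f : BoxHom m n) (x : Vtx m) (i : Fin m) (h : x i = false) :
    ∃ k, f x k = false ∧ f (Function.update x i true) = Function.update (f x) k true := by
  have h1 := f.adj _ _ (dist_update x i h)
  have h2 : f x ≤ f (Function.update x i true) := f.strictMono.monotone (lt_update x i h).le
  rw [hammingDist, Finset.card_eq_one] at h1
  obtain ⟨k, hk⟩ := h1
  have hk' : ∀ j, f x j ≠ f (Function.update x i true) j ↔ j = k := fun j => by
    have := Finset.ext_iff.1 hk j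
    simpa using this
  have h3 := h2 k
  have h4 := (hk' k).2 rfl
  have h5 : f x k = false ∧ f (Function.update x i true) k = true := by
    revert h3 h4
    cases f x k <;> cases f (Function.update x i true) k <;> simp
  refine ⟨k, h5.1, funext fun j => ?_⟩
  by_cases hj : j = k
  · subst hj; simp [h5.2]
  · rw [Function.update_of_ne hj]
    by_contra hc
    exact hj ((hk' j).1 (Ne.symm hc))

theorem dir_swap {m n : ℕ} (f : BoxHom m n) (x : Vtx m) (i j : Fin m) (hij : i ≠ j)
    (hi : x i = false) (hj : x j = false) (k : Fin n) (h1 : f x k = false)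
    (h2 : f (Function.update x i true) = Function.update (f x) k true) :
    f (Function.update x j true) k = false ∧
      f (Function.update (Function.update x j true) i true) =
        Function.update (f (Function.update x j true)) k true := by
  obtain ⟨l, hl, hl'⟩ := f.exists_dir_at x j hj
  have hkl : k ≠ l := by
    rintro rfl
    have h := f.inj (h2.trans hl'.symm)
    have := congrFun h i
    rw [Function.update_self, Function.update_of_ne hij, hi] at this
    exact absurd this (by decide)
  have hi' : Function.update x j true i = false := by rw [Function.update_of_ne hij, hi]
  have hj' : Function.update x i true j = false := by rw [Function.update_of_ne hij.symm, hj]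
  obtain ⟨k', hk1, hk2⟩ := f.exists_dir_at _ i hi'
  obtain ⟨l', hl1, hl2⟩ := f.exists_dir_at _ j hj'
  have hc : Function.update (Function.update x j true) i true =
      Function.update (Function.update x i true) j true := Function.update_comm hij.symm _ _ _
  have h6 : Function.update (Function.update (f x) l true) k' true =
      Function.update (Function.update (f x) k true) l' true := by
    rw [← hl', ← h2, ← hk2, ← hl2, hc]
  have h7 : k' = k := by
    by_contra hne
    have := congrFun h6 k
    rw [Function.update_of_ne (Ne.symm hne), Function.update_of_ne hkl, h1] at this
    by_cases hkl' : k = l'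
    · subst hkl'; simp at this
    · rw [Function.update_of_ne hkl', Function.update_self] at this
      exact absurd this (by decide)
  subst h7
  exact ⟨hk1, hk2⟩

/-- Induction on the set of coordinates equal to `1`, the coordinate `i` staying equal to `0`. -/
theorem vtx_induction {n : ℕ} (i : Fin n) (p : Vtx n → Prop) (h0 : p (fun _ => false))
    (hs : ∀ (x : Vtx n) (j : Fin n), i ≠ j → x i = false → x j = false → p x →
      p (Function.update x j true)) (x : Vtx n) (hx : x i = false) : p x := by
  classical
  have key : ∀ s : Finset (Fin n), i ∉ s → p (fun j => decide (j ∈ s)) := by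
    intro s
    induction s using Finset.induction_on with
    | empty => intro _; simpa using h0
    | insert j s hj ih =>
      intro hi
      rw [Finset.mem_insert, not_or] at hi
      have h := hs _ j hi.1 (by simpa using hi.2) (by simpa using hj) (ih hi.2)
      convert h using 1
      funext l
      by_cases hl : l = j
      · subst hl; simp
      · simp [hl]
  have h := key (Finset.univ.filter fun j => x j = true) (by simp [hx])
  convert h using 1
  funext j
  simp

theorem exists_dir {m n : ℕ} (f : BoxHom m n) (i : Fin m) :
    ∃ k, ∀ x : Vtx m, x i = false →
      f x k = false ∧ f (Function.update x i true) = Function.update (f x) k true := by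
  obtain ⟨k, hk⟩ := f.exists_dir_at (fun _ => false) i rfl
  refine ⟨k, fun x hx => ?_⟩
  refine vtx_induction i (fun x => f x k = false ∧
    f (Function.update x i true) = Function.update (f x) k true) hk ?_ x hx
  intro x j hij hi hj h
  exact f.dir_swap x i j hij hi hj k h.1 h.2

/-- The direction of `[n]` to which the `i`-th direction of `[m]` is sent by `f : [m] → [n]`:
raising the `i`-th coordinate of a vertex raises the `dir i`-th coordinate of its image. -/
noncomputable def dir {m n : ℕ} (f : BoxHom m n) (i : Fin m) : Fin n := (f.exists_dir i).choose

theorem dir_low {m n : ℕ} (f : BoxHom m n) (i : Fin m) (x : Vtx m) (h : x i = false) :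
    f x (f.dir i) = false := ((f.exists_dir i).choose_spec x h).1

theorem dir_update {m n : ℕ} (f : BoxHom m n) (i : Fin m) (x : Vtx m) (h : x i = false) :
    f (Function.update x i true) = Function.update (f x) (f.dir i) true :=
  ((f.exists_dir i).choose_spec x h).2

theorem dir_unique {m n : ℕ} (f : BoxHom m n) (i : Fin m) (x : Vtx m) (k : Fin n)
    (h : x i = false) (h1 : f x k = false)
    (h2 : f (Function.update x i true) = Function.update (f x) k true) : f.dir i = k := by
  by_contra hne
  have := congrFun ((f.dir_update i x h).symm.trans h2) k
  rw [Function.update_of_ne (Ne.symm hne), Function.update_self, h1] at this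
  exact absurd this (by decide)

@[simp] theorem dir_id (n : ℕ) (i : Fin n) : (BoxHom.id n).dir i = i :=
  dir_unique _ i (fun _ => false) i rfl rfl rfl

@[simp] theorem dir_comp {m n p : ℕ} (g : BoxHom n p) (f : BoxHom m n) (i : Fin m) :
    (g.comp f).dir i = g.dir (f.dir i) := by
  have h := f.dir_low i (fun _ => false) rfl
  refine dir_unique _ i (fun _ => false) _ rfl (g.dir_low _ _ h) ?_
  rw [comp_apply, comp_apply, f.dir_update i _ rfl, g.dir_update _ _ h]

theorem apply_dir {m n : ℕ} (f : BoxHom m n) (i : Fin m) (x : Vtx m) : f x (f.dir i) = x i := by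
  cases h : x i with
  | false => exact f.dir_low i x h
  | true =>
    have h1 : x = Function.update (Function.update x i false) i true := by
      rw [Function.update_idem, ← h, Function.update_eq_self]
    rw [h1, f.dir_update i _ (Function.update_self ..), Function.update_self]

theorem apply_not_dir {m n : ℕ} (f : BoxHom m n) (k : Fin n) (hk : ∀ i, f.dir i ≠ k)
    (x : Vtx m) : f x k = f (fun _ => false) k := by
  classical
  have key : ∀ s : Finset (Fin m), f (fun j => decide (j ∈ s)) k = f (fun _ => false) k := by
    intro s
    induction s using Finset.induction_on with
    | empty => simp
    | insert j s hj ih =>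
      have h : (fun l => decide (l ∈ insert j s)) =
          Function.update (fun l => decide (l ∈ s)) j true := by
        funext l
        by_cases hl : l = j
        · subst hl; simp
        · simp [hl]
      rw [h, f.dir_update j _ (by simpa using hj), Function.update_of_ne (hk j).symm, ih]
  have h := key (Finset.univ.filter fun j => x j = true)
  convert h using 2
  funext j
  simp

theorem dir_injective {m n : ℕ} (f : BoxHom m n) : Function.Injective f.dir := by
  intro i j hij
  by_contra hne
  have h1 := f.apply_dir i (Function.update (fun _ => false) i true)
  have h2 := f.apply_dir j (Function.update (fun _ => false) i true)
  rw [hij, h2, Function.update_self, Function.update_of_ne (Ne.symm hne)] at h1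
  exact absurd h1 (by decide)

/-- Every coordinate of a morphism of `□_S` is a constant or a coordinate of the argument. -/
theorem exists_coord {m n : ℕ} (f : BoxHom m n) : ∃ h : Fin n → Fin m ⊕ Bool,
    (∀ x k, f x k = Sum.elim x (fun b => b) (h k)) ∧ ∀ i, h (f.dir i) = Sum.inl i := by
  classical
  refine ⟨fun k => if h : ∃ i, f.dir i = k then Sum.inl h.choose
    else Sum.inr (f (fun _ => false) k), fun x k => ?_, fun i => ?_⟩
  · by_cases h : ∃ i, f.dir i = k
    · beta_reduce
      rw [dif_pos h, Sum.elim_inl, ← f.apply_dir h.choose x, h.choose_spec]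
    · beta_reduce
      rw [dif_neg h, Sum.elim_inr]
      exact f.apply_not_dir k (fun i hi => h ⟨i, hi⟩) x
  · have h : ∃ i', f.dir i' = f.dir i := ⟨i, rfl⟩
    change (if h : ∃ i', f.dir i' = f.dir i then Sum.inl h.choose
      else Sum.inr (f (fun _ => false) (f.dir i))) = _
    rw [dif_pos h, f.dir_injective h.choose_spec]

end BoxHom

/-! ## Labelled symmetric precubical sets -/

/-- A labelled symmetric precubical set over the set of labels `A`: a presheaf `cube` over `□_S`
together with a map `label` to the presheaf `!^S A` of words, whose set of `n`-cubes is `A^n` and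
on which `f : [m] → [n]` acts by `(a_1, …, a_n) ↦ (a_{dir f 1}, …, a_{dir f m})`
(a face map removes a letter, a symmetry map exchanges two letters). -/
structure LSPS (A : Type u) where
  cube : ℕ → Type u
  map : ∀ {m n : ℕ}, BoxHom m n → cube n → cube m
  map_id : ∀ {n : ℕ} (x : cube n), map (BoxHom.id n) x = x
  map_comp : ∀ {m n p : ℕ} (g : BoxHom n p) (f : BoxHom m n) (x : cube p),
    map (g.comp f) x = map f (map g x)
  label : ∀ {n : ℕ}, cube n → Fin n → A
  label_map : ∀ {m n : ℕ} (f : BoxHom m n) (x : cube n), label (map f x) = label x ∘ f.dir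

/-- Morphisms of labelled symmetric precubical sets. -/
structure LSPS.Hom {A : Type u} (K L : LSPS A) where
  app : ∀ {n : ℕ}, K.cube n → L.cube n
  app_map : ∀ {m n : ℕ} (f : BoxHom m n) (x : K.cube n), app (K.map f x) = L.map f (app x)
  label_app : ∀ {n : ℕ} (x : K.cube n), L.label (app x) = K.label x

theorem LSPS.Hom.ext {A : Type u} {K L : LSPS A} {φ ψ : LSPS.Hom K L}
    (h : ∀ (n : ℕ) (x : K.cube n), φ.app x = ψ.app x) : φ = ψ := by
  cases φ; cases ψ; congr; funext n x; exact h n x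

instance (A : Type u) : Category (LSPS A) where
  Hom := LSPS.Hom
  id K := ⟨fun x => x, fun _ _ => rfl, fun _ => rfl⟩
  comp φ ψ := ⟨fun x => ψ.app (φ.app x), fun f x => by rw [φ.app_map, ψ.app_map],
    fun x => by rw [ψ.label_app, φ.label_app]⟩

/-- A labelled symmetric precubical set with a distinguished (initial) state. -/
structure PLSPS (A : Type u) extends LSPS A where
  base : cube 0

structure PLSPS.Hom {A : Type u} (K L : PLSPS A) extends LSPS.Hom K.toLSPS L.toLSPS where
  app_base : app K.base = L.base

theorem PLSPS.Hom.ext {A : Type u} {K L : PLSPS A} {φ ψ : PLSPS.Hom K L}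
    (h : ∀ (n : ℕ) (x : K.cube n), φ.app x = ψ.app x) : φ = ψ := by
  have h' : φ.toHom = ψ.toHom := LSPS.Hom.ext h
  cases φ; cases ψ; cases h'; rfl

instance (A : Type u) : Category (PLSPS A) where
  Hom := PLSPS.Hom
  id K := ⟨𝟙 K.toLSPS, rfl⟩
  comp φ ψ := ⟨⟨fun x => ψ.app (φ.app x), fun f x => by rw [φ.app_map, ψ.app_map],
    fun x => by rw [ψ.label_app, φ.label_app]⟩, by
      change ψ.app (φ.app _) = _
      rw [φ.app_base, ψ.app_base]⟩

/-- Restriction of a labelled symmetric precubical set to a set of cubes which is stable under the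
action of `□_S`. -/
def LSPS.sub {A : Type u} (K : LSPS A) (p : ∀ {n : ℕ}, K.cube n → Prop)
    (hp : ∀ {m n : ℕ} (f : BoxHom m n) (x : K.cube n), p x → p (K.map f x)) : LSPS A where
  cube n := { x : K.cube n // p x }
  map f x := ⟨K.map f x.1, hp f x.1 x.2⟩
  map_id x := Subtype.ext (K.map_id x.1)
  map_comp g f x := Subtype.ext (K.map_comp g f x.1)
  label x := K.label x.1
  label_map f x := K.label_map f x.1

/-- The quotient of a labelled symmetric precubical set by the equivalence relation generated by
a relation which is stable under the action of `□_S` and preserves the labels. -/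
def LSPS.quot {A : Type u} (K : LSPS A) (r : ∀ {n : ℕ}, K.cube n → K.cube n → Prop)
    (hr : ∀ {m n : ℕ} (f : BoxHom m n) (x y : K.cube n), r x y → r (K.map f x) (K.map f y))
    (hl : ∀ {n : ℕ} (x y : K.cube n), r x y → K.label x = K.label y) : LSPS A where
  cube n := Quot (r (n := n))
  map f := Quot.map (K.map f) (hr f)
  map_id := by rintro n ⟨x⟩; exact congrArg (Quot.mk _) (K.map_id x)
  map_comp := by rintro m n p g f ⟨x⟩; exact congrArg (Quot.mk _) (K.map_comp g f x)
  label := Quot.lift K.label hl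
  label_map := by rintro m n f ⟨x⟩; exact K.label_map f x

/-- The disjoint union of a family of labelled symmetric precubical sets. -/
def LSPS.sigma {A : Type u} {ι : Type u} (K : ι → LSPS A) : LSPS A where
  cube n := Σ i, (K i).cube n
  map f x := ⟨x.1, (K x.1).map f x.2⟩
  map_id x := Sigma.ext rfl (heq_of_eq ((K x.1).map_id x.2))
  map_comp g f x := Sigma.ext rfl (heq_of_eq ((K x.1).map_comp g f x.2))
  label x := (K x.1).label x.2
  label_map f x := (K x.1).label_map f x.2

/-- The disjoint union of two labelled symmetric precubical sets. -/
def LSPS.sum {A : Type u} (K L : LSPS A) : LSPS A where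
  cube n := K.cube n ⊕ L.cube n
  map f := Sum.map (K.map f) (L.map f)
  map_id := by rintro n (x | x) <;> simp [K.map_id, L.map_id]
  map_comp := by rintro m n p g f (x | x) <;> simp [K.map_comp, L.map_comp]
  label := Sum.elim K.label L.label
  label_map := by rintro m n f (x | x) <;> simp [K.label_map, L.label_map]

/-- The labelled `n`-cube `□_S[a_1, …, a_n]`, i.e. the representable presheaf `□_S(-,[n])` with
the labelling `f ↦ f^*(a_1, …, a_n)`. -/
noncomputable def stdCube {A : Type u} {n : ℕ} (a : Fin n → A) : LSPS A where
  cube k := ULift.{u} (BoxHom k n)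
  map f x := ⟨x.down.comp f⟩
  map_id _ := rfl
  map_comp _ _ _ := rfl
  label x := a ∘ x.down.dir
  label_map f x := by funext i; simp

/-- The boundary `∂□_S[a_1, …, a_n]`: its `k`-cubes are those of `□_S[a_1, …, a_n]` for `k < n`,
and it has no `k`-cubes for `k ≥ n`. -/
noncomputable def stdBoundary {A : Type u} {n : ℕ} (a : Fin n → A) : LSPS A :=
  (stdCube a).sub (fun {k} _ => k < n) (fun f _ h => f.dim_le.trans_lt h)

/-- The inclusion `∂□_S[a_1, …, a_n] ⊂ □_S[a_1, …, a_n]`. -/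
noncomputable def boundaryIncl {A : Type u} {n : ℕ} (a : Fin n → A) : stdBoundary a ⟶ stdCube a :=
  LSPS.Hom.mk (fun x => x.1) (fun _ _ => rfl) (fun _ => rfl)

/-- The HDA paradigm: for every `p ≥ 2`, every labelled `p`-shell of `K` can be filled by at most
one labelled `p`-cube. -/
def HDAParadigm {A : Type u} (K : LSPS A) : Prop :=
  ∀ (p : ℕ), 2 ≤ p → ∀ (a : Fin p → A) (s : stdBoundary a ⟶ K) (k k' : stdCube a ⟶ K),
    boundaryIncl a ≫ k = s → boundaryIncl a ≫ k' = s → k = k'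

/-! ## Higher dimensional transition systems -/

/-- A weak higher dimensional transition system over the set of labels `A`. The list
`[u_1, …, u_n]` stands for the `n`-tuple `(u_1, …, u_n)`: `Tr α [u_1, …, u_n] β` means that
`(α, u_1, …, u_n, β)` is an `n`-transition. -/
structure WHDTS (A : Type u) where
  State : Type u
  Action : Type u
  label : Action → A
  Tr : State → List Action → State → Prop
  tr_ne_nil : ∀ {α l β}, Tr α l β → l ≠ []
  multiset : ∀ {α l l' β}, l.Perm l' → Tr α l β → Tr α l' β
  coherence : ∀ {α β ν₁ ν₂ l₁ l₂ l₃}, l₁ ≠ [] → l₂ ≠ [] → l₃ ≠ [] →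
    Tr α (l₁ ++ l₂ ++ l₃) β → Tr α l₁ ν₁ → Tr ν₁ (l₂ ++ l₃) β → Tr α (l₁ ++ l₂) ν₂ →
    Tr ν₂ l₃ β → Tr ν₁ l₂ ν₂

namespace WHDTS

variable {A : Type u} (X : WHDTS A)

/-- First Cattani-Sassone axiom. -/
def CSA1 : Prop :=
  ∀ (α β : X.State) (u u' : X.Action), X.Tr α [u] β → X.Tr α [u'] β →
    X.label u = X.label u' → u = u'

/-- Second Cattani-Sassone axiom. -/
def CSA2 : Prop :=
  ∀ (α β : X.State) (l₁ l₂ : List X.Action), l₁ ≠ [] → l₂ ≠ [] → X.Tr α (l₁ ++ l₂) β →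
    (∃! ν₁, X.Tr α l₁ ν₁ ∧ X.Tr ν₁ l₂ β) ∧ (∃! ν₂, X.Tr α l₂ ν₂ ∧ X.Tr ν₂ l₁ β)

/-- Third Cattani-Sassone axiom. -/
def CSA3 : Prop :=
  ∀ (α β ν₁ ν₂ ν₁' ν₂' : X.State) (l₁ l₂ l₃ : List X.Action), l₁ ≠ [] → l₂ ≠ [] → l₃ ≠ [] →
    X.Tr α (l₁ ++ l₂ ++ l₃) β → X.Tr α l₁ ν₁ → X.Tr ν₁ (l₂ ++ l₃) β → X.Tr ν₁ l₂ ν₂ →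
    X.Tr ν₂ l₃ β → X.Tr α (l₁ ++ l₂) ν₂' → X.Tr ν₂' l₃ β → X.Tr α l₁ ν₁' → X.Tr ν₁' l₂ ν₂' →
    ν₁ = ν₁' ∧ ν₂ = ν₂'

/-- The Unique intermediate state axiom. -/
def UniqueIntermediateState : Prop :=
  ∀ (α β : X.State) (l₁ l₂ : List X.Action), l₁ ≠ [] → l₂ ≠ [] → X.Tr α (l₁ ++ l₂) β →
    ∃! ν, X.Tr α l₁ ν ∧ X.Tr ν l₂ β

/-- A (Cattani-Sassone) higher dimensional transition system. The Multiset axiom is already part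
of the structure `WHDTS`. -/
def IsHDTS : Prop := X.CSA1 ∧ X.CSA2 ∧ X.CSA3

end WHDTS

/-- Morphisms of weak higher dimensional transition systems. -/
@[ext] structure WHDTS.Hom {A : Type u} (X Y : WHDTS A) where
  onState : X.State → Y.State
  onAction : X.Action → Y.Action
  label_onAction : ∀ a, Y.label (onAction a) = X.label a
  tr_map : ∀ {α l β}, X.Tr α l β → Y.Tr (onState α) (l.map onAction) (onState β)

instance (A : Type u) : Category (WHDTS A) where
  Hom := WHDTS.Hom
  id X := ⟨fun x => x, fun a => a, fun _ => rfl, fun h => by simpa using h⟩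
  comp φ ψ := ⟨fun x => ψ.onState (φ.onState x), fun a => ψ.onAction (φ.onAction a),
    fun a => by rw [ψ.label_onAction, φ.label_onAction],
    fun h => by simpa [Function.comp_def] using ψ.tr_map (φ.tr_map h)⟩

/-- The transitions `(x, (a_{i_1}, i_1), …, (a_{i_d}, i_d), y)` of the labelled `n`-cube. The
action `(a_i, i)` is represented by the index `i`. -/
def CubeTr {n : ℕ} (x : Vtx n) (l : List (Fin n)) (y : Vtx n) : Prop :=
  l ≠ [] ∧ l.Nodup ∧ x ≤ y ∧ ∀ i, x i ≠ y i ↔ i ∈ l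

/-- The labelled `n`-cube `C_n[a_1, …, a_n]` as a weak higher dimensional transition system. -/
def cubeWHDTS {A : Type u} {n : ℕ} (a : Fin n → A) : WHDTS A where
  State := ULift.{u} (Vtx n)
  Action := ULift.{u} (Fin n)
  label i := a i.down
  Tr x l y := CubeTr x.down (l.map ULift.down) y.down
  tr_ne_nil := by
    rintro α l β ⟨h, -⟩ rfl
    exact h rfl
  multiset := by
    rintro α l l' β hl ⟨h1, h2, h3, h4⟩
    have hl' := hl.map ULift.down
    refine ⟨fun h => h1 ?_, hl'.nodup_iff.1 h2, h3, fun i => (h4 i).trans hl'.mem_iff⟩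
    rw [h] at hl'
    exact hl'.eq_nil
  coherence := by
    rintro ⟨α⟩ ⟨β⟩ ⟨ν₁⟩ ⟨ν₂⟩ l₁ l₂ l₃ - hl₂ - ⟨-, hn, hab, ha⟩ ⟨-, -, -, h1⟩ ⟨-, -, -, h2⟩
      ⟨-, -, -, h3⟩ ⟨-, -, -, h4⟩
    simp only [List.map_append, List.mem_append] at *
    have key : ∀ i, ν₁ i ≤ ν₂ i ∧ (ν₁ i ≠ ν₂ i ↔ i ∈ l₂.map ULift.down) := by
      intro i
      rw [List.nodup_append, List.nodup_append] at hn
      have e1 : i ∈ l₁.map ULift.down → i ∉ l₂.map ULift.down :=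
        fun hi hi' => hn.1.2.2 i hi i hi' rfl
      have e2 : i ∈ l₁.map ULift.down ∨ i ∈ l₂.map ULift.down → i ∉ l₃.map ULift.down :=
        fun hi hi' => hn.2.2 i (List.mem_append.2 hi) i hi' rfl
      have hab := hab i
      have ha := ha i
      have h1 := h1 i
      have h2 := h2 i
      have h3 := h3 i
      have h4 := h4 i
      revert hab ha h1 h2 h3 h4 e1 e2
      generalize (i ∈ l₁.map ULift.down) = p
      generalize (i ∈ l₂.map ULift.down) = q
      generalize (i ∈ l₃.map ULift.down) = r
      cases α i <;> cases β i <;> cases ν₁ i <;> cases ν₂ i <;> simp <;> tauto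
    exact ⟨by simpa using hl₂, (List.nodup_append.1 (List.nodup_append.1 hn).1).2.1,
      fun i => (key i).1, fun i => (key i).2⟩

/-- The map `C_m[a ∘ dir f] → C_n[a]` induced by `f : [m] → [n]`. -/
noncomputable def cubeWHDTSMap {A : Type u} {m n : ℕ} (f : BoxHom m n) (a : Fin m → A)
    (b : Fin n → A) (h : a = b ∘ f.dir) : cubeWHDTS a ⟶ cubeWHDTS b :=
  WHDTS.Hom.mk (fun x => ⟨f x.down⟩) (fun i => ⟨f.dir i.down⟩) (fun i => by subst h; rfl) (by
    rintro ⟨x⟩ (l : List (ULift (Fin m))) ⟨y⟩ ⟨h1, h2, h3, h4⟩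
    have e : (l.map fun i : ULift (Fin m) => (⟨f.dir i.down⟩ : ULift (Fin n))).map ULift.down =
        (l.map ULift.down).map f.dir := by simp
    change CubeTr (f x) ((l.map fun i : ULift (Fin m) =>
      (⟨f.dir i.down⟩ : ULift (Fin n))).map ULift.down) (f y)
    rw [e]
    refine ⟨by simpa using h1, h2.map f.dir_injective, f.strictMono.monotone h3, fun k => ?_⟩
    by_cases hk : ∃ i, f.dir i = k
    · obtain ⟨i, rfl⟩ := hk
      rw [f.apply_dir, f.apply_dir, List.mem_map_of_injective f.dir_injective]
      exact h4 i
    · have hk' : ∀ i, f.dir i ≠ k := fun i hi => hk ⟨i, hi⟩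
      rw [f.apply_not_dir k hk' x, f.apply_not_dir k hk' y]
      simp only [ne_eq, not_true_eq_false, false_iff, List.mem_map, not_exists, not_and]
      exact fun i _ hi => hk ⟨i, hi⟩)

/-! ## The realization of a labelled symmetric precubical set

The realization `𝕋(K)` is the colimit of the `C_n[a_1, …, a_n]` over the cubes
`□_S[a_1, …, a_n] → K` of `K`. Its states and its actions form the colimits of the sets of states
and of actions of the cubes, and its transitions are obtained by closing the union of the images
of the transitions of the cubes under the Multiset axiom and the Coherence axiom. -/

section Realization

variable {A : Type u} (K : LSPS A)

inductive StateRel : (Σ n : ℕ, K.cube n × Vtx n) → (Σ n : ℕ, K.cube n × Vtx n) → Prop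
  | mk {m n : ℕ} (f : BoxHom m n) (x : K.cube n) (v : Vtx m) :
      StateRel ⟨m, K.map f x, v⟩ ⟨n, x, f v⟩

inductive ActionRel : (Σ n : ℕ, K.cube n × Fin n) → (Σ n : ℕ, K.cube n × Fin n) → Prop
  | mk {m n : ℕ} (f : BoxHom m n) (x : K.cube n) (i : Fin m) :
      ActionRel ⟨m, K.map f x, i⟩ ⟨n, x, f.dir i⟩

/-- The colimit of the sets of states of the cubes of `K`. -/
def RState : Type u := Quot (StateRel K)

/-- The colimit of the sets of actions of the cubes of `K`. -/
def RAction : Type u := Quot (ActionRel K)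

/-- The image in the realization of a vertex of a cube of `K`. -/
def rState {n : ℕ} (x : K.cube n) (v : Vtx n) : RState K := Quot.mk _ ⟨n, x, v⟩

/-- The image in the realization of an action of a cube of `K`. -/
def rAction {n : ℕ} (x : K.cube n) (i : Fin n) : RAction K := Quot.mk _ ⟨n, x, i⟩

/-- The closure of the union of the transitions of the cubes under the Multiset axiom and the
Coherence axiom. -/
inductive RTr : RState K → List (RAction K) → RState K → Prop
  | cube {n : ℕ} (x : K.cube n) (v w : Vtx n) (l : List (Fin n)) :
      CubeTr v l w → RTr (rState K x v) (l.map (rAction K x)) (rState K x w)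
  | multiset {α β : RState K} {l l' : List (RAction K)} : l.Perm l' → RTr α l β → RTr α l' β
  | coherence {α β ν₁ ν₂ : RState K} {l₁ l₂ l₃ : List (RAction K)} :
      l₁ ≠ [] → l₂ ≠ [] → l₃ ≠ [] → RTr α (l₁ ++ l₂ ++ l₃) β → RTr α l₁ ν₁ →
      RTr ν₁ (l₂ ++ l₃) β → RTr α (l₁ ++ l₂) ν₂ → RTr ν₂ l₃ β → RTr ν₁ l₂ ν₂

/-- The realization `𝕋(K)` of `K` as a weak higher dimensional transition system. -/
def realization : WHDTS A where
  State := RState K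
  Action := RAction K
  label := Quot.lift (fun p => K.label p.2.1 p.2.2) (by
    rintro _ _ ⟨f, x, i⟩
    simp [K.label_map])
  Tr := RTr K
  tr_ne_nil := by
    intro α l β h
    induction h with
    | cube x v w l h => simpa using h.1
    | multiset hl _ ih => exact fun h => ih (by rw [h] at hl; exact hl.eq_nil)
    | coherence _ h _ _ _ _ _ _ _ _ _ _ _ => exact h
  multiset := RTr.multiset
  coherence := RTr.coherence

/-- The canonical map from a cube of `K` to the realization. -/
def toRealization {n : ℕ} (x : K.cube n) : cubeWHDTS (K.label x) ⟶ realization K :=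
  WHDTS.Hom.mk (fun v => rState K x v.down) (fun i => rAction K x i.down) (fun _ => rfl) (by
    intro v l w h
    have e := RTr.cube x _ _ _ h
    have e' : (l.map ULift.down).map (rAction K x) = l.map fun i => rAction K x i.down :=
      List.map_map
    exact (congrArg (fun t => RTr K _ t _) e').mp e)

/-- The canonical maps form a cocone on the diagram of the cubes of `K`. -/
theorem toRealization_natural {m n : ℕ} (f : BoxHom m n) (x : K.cube n) :
    cubeWHDTSMap f _ _ (K.label_map f x) ≫ toRealization K x = toRealization K (K.map f x) := by
  refine WHDTS.Hom.ext (funext fun v => ?_) (funext fun i => ?_)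
  · exact (Quot.sound (StateRel.mk f x v.down)).symm
  · exact (Quot.sound (ActionRel.mk f x i.down)).symm

/-- The realization is the colimit of the diagram of the cubes of `K`. -/
theorem realization_universal (X : WHDTS A)
    (c : ∀ {n : ℕ} (x : K.cube n), cubeWHDTS (K.label x) ⟶ X)
    (hc : ∀ {m n : ℕ} (f : BoxHom m n) (x : K.cube n),
      cubeWHDTSMap f _ _ (K.label_map f x) ≫ c x = c (K.map f x)) :
    ∃! φ : realization K ⟶ X, ∀ {n : ℕ} (x : K.cube n), toRealization K x ≫ φ = c x := by
  let fS : RState K → X.State := Quot.lift (fun p => (c p.2.1).onState ⟨p.2.2⟩) (by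
    rintro _ _ ⟨f, x, v⟩
    exact (congrFun (congrArg WHDTS.Hom.onState (hc f x)) ⟨v⟩).symm)
  let fA : RAction K → X.Action := Quot.lift (fun p => (c p.2.1).onAction ⟨p.2.2⟩) (by
    rintro _ _ ⟨f, x, i⟩
    exact (congrFun (congrArg WHDTS.Hom.onAction (hc f x)) ⟨i⟩).symm)
  have htr : ∀ {α l β}, RTr K α l β → X.Tr (fS α) (l.map fA) (fS β) := by
    intro α l β h
    induction h with
    | cube x v w l h =>
      have := (c x).tr_map (α := ⟨v⟩) (l := l.map ULift.up) (β := ⟨w⟩) (by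
        change CubeTr v ((l.map ULift.up).map ULift.down) w
        simpa [Function.comp_def] using h)
      have e : (l.map ULift.up).map (c x).onAction = (l.map (rAction K x)).map fA := by
        rw [List.map_map]
        exact List.map_map
      exact (congrArg (fun t => X.Tr _ t _) e).mp this
    | multiset hl _ ih => exact X.multiset (hl.map fA) ih
    | coherence h1 h2 h3 _ _ _ _ _ ih1 ih2 ih3 ih4 ih5 =>
      simp only [List.map_append] at *
      exact X.coherence (by simpa using h1) (by simpa using h2) (by simpa using h3)
        ih1 ih2 ih3 ih4 ih5
  refine ⟨WHDTS.Hom.mk fS fA ?_ htr, fun x => rfl, fun ψ hψ => ?_⟩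
  · rintro ⟨⟨n, x, i⟩⟩
    exact (c x).label_onAction ⟨i⟩
  · refine WHDTS.Hom.ext (funext ?_) (funext ?_)
    · rintro ⟨⟨n, x, v⟩⟩
      exact congrFun (congrArg WHDTS.Hom.onState (hψ x)) ⟨v⟩
    · rintro ⟨⟨n, x, i⟩⟩
      exact congrFun (congrArg WHDTS.Hom.onAction (hψ x)) ⟨i⟩

end Realization

/-! ## Labelled graphs (1-dimensional labelled symmetric precubical sets) -/

/-- A labelled symmetric precubical set of dimension at most `1`, i.e. a labelled presheaf over the
full subcategory of `□_S` with the objects `[0]` and `[1]`: it is given by its `0`-cubes, its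
`1`-cubes, the two face maps and the labels of the `1`-cubes. (Only truncations of cubes and their
fibered products are used, so these sets can be taken in `Type`.) -/
structure LGraph (A : Type u) where
  V : Type
  E : Type
  src : E → V
  tgt : E → V
  lab : E → A

structure LGraph.Hom {A : Type u} (G H : LGraph A) where
  onV : G.V → H.V
  onE : G.E → H.E
  src_onE : ∀ e, H.src (onE e) = onV (G.src e)
  tgt_onE : ∀ e, H.tgt (onE e) = onV (G.tgt e)
  lab_onE : ∀ e, H.lab (onE e) = G.lab e

def LGraph.Hom.comp {A : Type u} {G H I : LGraph A} (ψ : LGraph.Hom H I) (φ : LGraph.Hom G H) :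
    LGraph.Hom G I where
  onV v := ψ.onV (φ.onV v)
  onE e := ψ.onE (φ.onE e)
  src_onE e := by rw [ψ.src_onE, φ.src_onE]
  tgt_onE e := by rw [ψ.tgt_onE, φ.tgt_onE]
  lab_onE e := by rw [ψ.lab_onE, φ.lab_onE]

/-- The truncation `□_S[a_1, …, a_n]_{≤ 1}` of the labelled `n`-cube. Its set of vertices
`□_S([0],[n])` is identified with `[n]`, and its set of edges is `□_S([1],[n])`. -/
noncomputable abbrev cubeGraph {A : Type u} {n : ℕ} (a : Fin n → A) : LGraph A where
  V := Vtx n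
  E := BoxHom 1 n
  src e := e (fun _ => false)
  tgt e := e (fun _ => true)
  lab e := a (e.dir 0)

noncomputable def cubeGraphMap {A : Type u} {m n : ℕ} (f : BoxHom m n) {a : Fin m → A}
    {b : Fin n → A} (h : a = b ∘ f.dir) : LGraph.Hom (cubeGraph a) (cubeGraph b) where
  onV v := f v
  onE e := f.comp e
  src_onE _ := rfl
  tgt_onE _ := rfl
  lab_onE e := by
    subst h
    exact congrArg b (BoxHom.dir_comp f e 0)

/-- A set of labels `A` with the distinguished label `τ` and the involution `a ↦ \bar a` on
`A \ {τ}`. -/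
structure SyncLabels (A : Type u) where
  tau : A
  bar : { a : A // a ≠ tau } → { a : A // a ≠ tau }
  bar_bar : Function.Involutive bar

/-- The labels `a` and `b` synchronize: `a ≠ τ` and `\bar a = b`. -/
def SyncLabels.Sync {A : Type u} (S : SyncLabels A) (a b : A) : Prop :=
  ∃ h : a ≠ S.tau, (S.bar ⟨a, h⟩ : A) = b

/-- The fibered product over the set of labels: an edge is an edge of `G` with a vertex of `H`, or
a vertex of `G` with an edge of `H`, or a synchronization, labelled by `τ`, of an edge of `G` and
an edge of `H` with conjugate labels. -/
abbrev fiberedProduct {A : Type u} (S : SyncLabels A) (G H : LGraph A) : LGraph A where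
  V := G.V × H.V
  E := (G.E × H.V) ⊕ (G.V × H.E) ⊕ { p : G.E × H.E // S.Sync (G.lab p.1) (H.lab p.2) }
  src := Sum.elim (fun p => (G.src p.1, p.2))
    (Sum.elim (fun p => (p.1, H.src p.2)) (fun p => (G.src p.1.1, H.src p.1.2)))
  tgt := Sum.elim (fun p => (G.tgt p.1, p.2))
    (Sum.elim (fun p => (p.1, H.tgt p.2)) (fun p => (G.tgt p.1.1, H.tgt p.1.2)))
  lab := Sum.elim (fun p => G.lab p.1) (Sum.elim (fun p => H.lab p.2) (fun _ => S.tau))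

def fiberedProductMap {A : Type u} (S : SyncLabels A) {G H G' H' : LGraph A}
    (φ : LGraph.Hom G G') (ψ : LGraph.Hom H H') :
    LGraph.Hom (fiberedProduct S G H) (fiberedProduct S G' H') where
  onV := Prod.map φ.onV ψ.onV
  onE := Sum.map (Prod.map φ.onE ψ.onV) (Sum.map (Prod.map φ.onV ψ.onE)
    (fun p => ⟨(φ.onE p.1.1, ψ.onE p.1.2), by
      have h := p.2
      rwa [← φ.lab_onE, ← ψ.lab_onE] at h⟩))
  src_onE := by
    rintro (e | e | e) <;> simp [fiberedProduct, φ.src_onE, ψ.src_onE]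
  tgt_onE := by
    rintro (e | e | e) <;> simp [fiberedProduct, φ.tgt_onE, ψ.tgt_onE]
  lab_onE := by
    rintro (e | e | e) <;> simp [φ.lab_onE, ψ.lab_onE]

/-! ## The labelled symmetric directed coskeleton -/

theorem sigma_hom_ext {A : Type u} {n : ℕ} {G : LGraph A}
    {x y : Σ a : Fin n → A, LGraph.Hom (cubeGraph a) G} (h : x.1 = y.1)
    (hV : ∀ v : Vtx n, x.2.onV v = y.2.onV v) (hE : ∀ e : BoxHom 1 n, x.2.onE e = y.2.onE e) :
    x = y := by
  obtain ⟨a, x⟩ := x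
  obtain ⟨b, y⟩ := y
  cases h
  have h : x = y := by
    cases x; cases y
    congr
    · exact funext hV
    · exact funext hE
  rw [h]

/-- The labelled coskeleton `cosk_1` of a labelled graph `G` (the right adjoint of the truncation
functor): its `n`-cubes labelled by the word `(a_1, …, a_n)` are the morphisms of labelled graphs
`□_S[a_1, …, a_n]_{≤ 1} → G`. -/
noncomputable def cosk {A : Type u} (G : LGraph A) : LSPS A where
  cube n := Σ a : Fin n → A, LGraph.Hom (cubeGraph a) G
  map f x := ⟨x.1 ∘ f.dir, x.2.comp (cubeGraphMap f rfl)⟩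
  map_id x := sigma_hom_ext (by funext i; simp) (fun _ => rfl) (fun _ => rfl)
  map_comp g f x := sigma_hom_ext (by funext i; simp) (fun _ => rfl) (fun _ => rfl)
  label x := x.1
  label_map _ _ := rfl

/-- The face map `δ_i^α : [n] → [n+1]`, which inserts `α` as `i`-th coordinate. -/
def faceMap {n : ℕ} (i : Fin (n + 1)) (α : Bool) (x : Vtx n) : Vtx (n + 1) :=
  i.insertNth (α := fun _ => Bool) α x

/-- The morphisms of the reduced box category `□`: the composites of face maps. -/
inductive IsFaceComposite : ∀ {m n : ℕ}, (Vtx m → Vtx n) → Prop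
  | id (n : ℕ) : IsFaceComposite (fun x : Vtx n => x)
  | comp {m n : ℕ} (i : Fin (n + 1)) (α : Bool) (f : Vtx m → Vtx n) :
      IsFaceComposite f → IsFaceComposite (fun x => faceMap i α (f x))

/-- A map `x₀ : [n] → [p]` is non-twisted if it is a composite `[n] → [q] → [p]` of a map of the
form `(ε_1, …, ε_n) ↦ (ε_{i_1}, …, ε_{i_q})` with `{1, …, n} ⊂ {i_1, …, i_q}` and of a morphism
of `□`. -/
def NonTwisted {n p : ℕ} (x₀ : Vtx n → Vtx p) : Prop :=
  ∃ (q : ℕ) (i : Fin q → Fin n) (ψ : Vtx q → Vtx p), Function.Surjective i ∧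
    IsFaceComposite ψ ∧ ∀ ε : Vtx n, x₀ ε = ψ (fun j => ε (i j))

theorem IsFaceComposite.exists_coord {q p : ℕ} {ψ : Vtx q → Vtx p} (hψ : IsFaceComposite ψ) :
    ∃ h : Fin p → Fin q ⊕ Bool,
      (∀ ε k, ψ ε k = Sum.elim ε (fun b => b) (h k)) ∧ ∀ i, ∃ k, h k = Sum.inl i := by
  induction hψ with
  | id => exact ⟨Sum.inl, fun _ _ => rfl, fun i => ⟨i, rfl⟩⟩
  | comp i α f _ ih =>
    obtain ⟨h, h1, h2⟩ := ih
    refine ⟨i.insertNth (α := fun _ => _) (Sum.inr α) h, fun ε k => ?_, fun j => ?_⟩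
    · refine Fin.succAboveCases i ?_ (fun k => ?_) k
      · simp [faceMap]
      · simp [faceMap, h1]
    · obtain ⟨k, hk⟩ := h2 j
      exact ⟨i.succAbove k, by simpa using hk⟩

theorem nonTwisted_iff {n p : ℕ} (x₀ : Vtx n → Vtx p) : NonTwisted x₀ ↔
    ∃ h : Fin p → Fin n ⊕ Bool, (∀ ε k, x₀ ε k = Sum.elim ε (fun b => b) (h k)) ∧
      ∀ i, ∃ k, h k = Sum.inl i := by
  constructor
  · rintro ⟨q, c, ψ, hc, hψ, hx⟩
    obtain ⟨h, h1, h2⟩ := hψ.exists_coord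
    refine ⟨fun k => Sum.map c (fun b => b) (h k), fun ε k => ?_, fun i => ?_⟩
    · rw [hx, h1]
      beta_reduce
      cases h k <;> rfl
    · obtain ⟨j, rfl⟩ := hc i
      obtain ⟨k, hk⟩ := h2 j
      exact ⟨k, by beta_reduce; rw [hk]; rfl⟩
  · rintro ⟨h, h1, h2⟩
    induction p with
    | zero =>
      have hn : ∀ i : Fin n, False := fun i => (h2 i).choose.elim0
      refine ⟨0, fun j => j.elim0, fun x => x, fun i => (hn i).elim, .id 0, fun ε => ?_⟩
      funext k
      exact k.elim0
    | succ p ih =>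
      by_cases hb : ∃ k b, h k = Sum.inr b
      · obtain ⟨k, b, hk⟩ := hb
        obtain ⟨q, c, ψ, hc, hψ, hx⟩ := ih (fun ε j => x₀ ε (k.succAbove j))
          (fun j => h (k.succAbove j)) (fun ε j => h1 ε _) (fun i => by
            obtain ⟨l, hl⟩ := h2 i
            have hne : l ≠ k := by
              rintro rfl
              rw [hk] at hl
              cases hl
            obtain ⟨j, rfl⟩ := Fin.exists_succAbove_eq hne
            exact ⟨j, hl⟩)
        refine ⟨q, c, fun x => faceMap k b (ψ x), hc, .comp k b ψ hψ, fun ε => ?_⟩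
        beta_reduce
        rw [← hx]
        funext l
        refine Fin.succAboveCases k ?_ (fun l => ?_) l
        · simp [faceMap, h1, hk]
        · simp [faceMap]
      · have hl : ∀ k, ∃ i, h k = Sum.inl i := by
          intro k
          cases hk : h k with
          | inl i => exact ⟨i, rfl⟩
          | inr b => exact (hb ⟨k, b, hk⟩).elim
        choose c hc using hl
        refine ⟨p + 1, c, fun x => x, fun i => ?_, .id _, fun ε => ?_⟩
        · obtain ⟨k, hk⟩ := h2 i
          rw [hc] at hk
          exact ⟨k, Sum.inl.inj hk⟩
        · funext k
          rw [h1, hc]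
          rfl

theorem NonTwisted.comp_box {m n p : ℕ} {x₀ : Vtx n → Vtx p} (hx : NonTwisted x₀)
    (f : BoxHom m n) : NonTwisted (fun ε => x₀ (f ε)) := by
  rw [nonTwisted_iff] at hx ⊢
  obtain ⟨h, h1, h2⟩ := hx
  obtain ⟨g, g1, g2⟩ := f.exists_coord
  refine ⟨fun k => Sum.elim g Sum.inr (h k), fun ε k => ?_, fun i => ?_⟩
  · rw [h1]
    beta_reduce
    cases h k with
    | inl i => simp [g1]
    | inr b => rfl
  · obtain ⟨k, hk⟩ := h2 (f.dir i)
    exact ⟨k, by beta_reduce; rw [hk]; exact g2 i⟩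

theorem NonTwisted.append_box {n p q p' q' : ℕ} {x : Vtx n → Vtx p} {y : Vtx n → Vtx q}
    (hx : NonTwisted (fun ε => Fin.append (x ε) (y ε))) (f : BoxHom p p') (g : BoxHom q q') :
    NonTwisted (fun ε => Fin.append (f (x ε)) (g (y ε))) := by
  rw [nonTwisted_iff] at hx ⊢
  obtain ⟨h, h1, h2⟩ := hx
  obtain ⟨hf, f1, f2⟩ := f.exists_coord
  obtain ⟨hg, g1, g2⟩ := g.exists_coord
  have hx : ∀ ε k, x ε k = Sum.elim ε (fun b => b) (h (Fin.castAdd q k)) := fun ε k => by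
    rw [← h1, Fin.append_left]
  have hy : ∀ ε k, y ε k = Sum.elim ε (fun b => b) (h (Fin.natAdd p k)) := fun ε k => by
    rw [← h1, Fin.append_right]
  refine ⟨Fin.append (fun k => Sum.elim (fun j => h (Fin.castAdd q j)) Sum.inr (hf k))
    (fun k => Sum.elim (fun j => h (Fin.natAdd p j)) Sum.inr (hg k)), fun ε k => ?_, fun i => ?_⟩
  · refine Fin.addCases (fun k => ?_) (fun k => ?_) k
    · rw [Fin.append_left, Fin.append_left, f1]
      cases hf k with
      | inl j => simp [hx]
      | inr b => rfl
    · rw [Fin.append_right, Fin.append_right, g1]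
      cases hg k with
      | inl j => simp [hy]
      | inr b => rfl
  · obtain ⟨k, hk⟩ := h2 i
    revert hk
    refine Fin.addCases (fun k hk => ?_) (fun k hk => ?_) k
    · exact ⟨Fin.castAdd q' (f.dir k), by rw [Fin.append_left, f2]; exact hk⟩
    · exact ⟨Fin.natAdd p' (g.dir k), by rw [Fin.append_right, g2]; exact hk⟩

/-- The labelled symmetric directed coskeleton of a labelled graph `G` whose set of vertices is
identified with `[p]` by the map `e`: the cubes of dimension at least `2` of `cosk G` are kept if
and only if they are non-twisted. -/
noncomputable def dirCosk {A : Type u} (G : LGraph A) {p : ℕ} (e : G.V → Vtx p) : LSPS A :=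
  (cosk G).sub (fun {n} x => 2 ≤ n → NonTwisted (fun ε : Vtx n => e (x.2.onV ε)))
    (fun f _ h hm => (h (hm.trans f.dim_le)).comp_box f)

/-- The directed coskeleton of `□_S[a_1, …, a_m]_{≤ 1} ×_Σ □_S[b_1, …, b_n]_{≤ 1}`, whose set of
vertices is `[m] × [n] = [m + n]`. -/
noncomputable def syncCube {A : Type u} (S : SyncLabels A) {m n : ℕ} (a : Fin m → A)
    (b : Fin n → A) : LSPS A :=
  dirCosk (fiberedProduct S (cubeGraph a) (cubeGraph b)) (Fin.appendEquiv m n)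

noncomputable def syncCubeMap {A : Type u} (S : SyncLabels A) {m n m' n' : ℕ} (f : BoxHom m m')
    (g : BoxHom n n') {a : Fin m → A} {a' : Fin m' → A} (ha : a = a' ∘ f.dir) {b : Fin n → A}
    {b' : Fin n' → A} (hb : b = b' ∘ g.dir) : syncCube S a b ⟶ syncCube S a' b' :=
  LSPS.Hom.mk
    (fun {k} x => ⟨⟨x.1.1,
      (fiberedProductMap S (cubeGraphMap f ha) (cubeGraphMap g hb)).comp x.1.2⟩,
      fun hk => NonTwisted.append_box (x := fun ε : Vtx k => (x.1.2.onV ε).1)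
        (y := fun ε : Vtx k => (x.1.2.onV ε).2) (x.2 hk) f g⟩)
    (fun _ _ => rfl) (fun _ => rfl)

/-! ## The synchronized tensor product -/

section Tensor

variable {A : Type u} (S : SyncLabels A)

/-- The disjoint union of the `syncCube`s over all pairs of cubes of `K` and `L`. -/
noncomputable def preTensor (K L : LSPS A) : LSPS A :=
  LSPS.sigma (ι := (Σ m : ℕ, K.cube m) × (Σ n : ℕ, L.cube n))
    (fun i => syncCube S (K.label i.1.2) (L.label i.2.2))

/-- The identifications defining the colimit over the pairs of cubes of `K` and `L`: for
`f : [m] → [m']` and `g : [n] → [n']`, a cube `c` in the component of `(f^* x, g^* y)` is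
identified with its image in the component of `(x, y)`. -/
inductive TensorRel (K L : LSPS A) {k : ℕ} :
    (preTensor S K L).cube k → (preTensor S K L).cube k → Prop
  | mk {m n m' n' : ℕ} (f : BoxHom m m') (g : BoxHom n n') (x : K.cube m') (y : L.cube n')
      (c : (syncCube S (K.label (K.map f x)) (L.label (L.map g y))).cube k) :
      TensorRel K L ⟨(⟨m, K.map f x⟩, ⟨n, L.map g y⟩), c⟩
        ⟨(⟨m', x⟩, ⟨n', y⟩), (syncCubeMap S f g (K.label_map f x) (L.label_map g y)).app c⟩

/-- The synchronized tensor product `K ⊗_Σ L`: the colimit, over the cubes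
`□_S[a_1, …, a_m] → K` of `K` and the cubes `□_S[b_1, …, b_n] → L` of `L`, of the directed
coskeleta of `□_S[a_1, …, a_m]_{≤ 1} ×_Σ □_S[b_1, …, b_n]_{≤ 1}`. -/
noncomputable def tensor (K L : LSPS A) : LSPS A :=
  (preTensor S K L).quot (TensorRel S K L)
    (by
      rintro k l h _ _ ⟨f, g, x, y, c⟩
      exact TensorRel.mk f g x y ((syncCube S _ _).map h c))
    (by rintro k _ _ ⟨f, g, x, y, c⟩; rfl)

/-- The state of `K ⊗_Σ L` given by a state of `K` and a state of `L`. -/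
noncomputable def tensorState (K L : LSPS A) (x : K.cube 0) (y : L.cube 0) :
    (tensor S K L).cube 0 :=
  Quot.mk _ ⟨(⟨0, x⟩, ⟨0, y⟩), ⟨⟨fun i => i.elim0,
    { onV := fun _ => (fun i => i.elim0, fun i => i.elim0)
      onE := fun e => absurd e.dim_le (by decide)
      src_onE := fun e => absurd e.dim_le (by decide)
      tgt_onE := fun e => absurd e.dim_le (by decide)
      lab_onE := fun e => absurd e.dim_le (by decide) }⟩, fun h => absurd h (by decide)⟩⟩

end Tensor

/-! ## The operations of CCS on pointed labelled symmetric precubical sets -/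

section Operations

variable {A : Type u}

/-- The relation gluing the state `x` of `K` and the state `y` of `L`; the map `[k] → [0]` exists
only for `k = 0`. -/
inductive GlueRel (K L : LSPS A) (x : K.cube 0) (y : L.cube 0) {k : ℕ} :
    (K.sum L).cube k → (K.sum L).cube k → Prop
  | mk (f : BoxHom k 0) : GlueRel K L x y (Sum.inl (K.map f x)) (Sum.inr (L.map f y))

/-- The pushout of the maps `x : □_S[0] → K` and `y : □_S[0] → L`. -/
def glue (K L : LSPS A) (x : K.cube 0) (y : L.cube 0) : LSPS A :=
  (K.sum L).quot (GlueRel K L x y)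
    (by
      rintro m n f _ _ ⟨g⟩
      have h := GlueRel.mk (K := K) (L := L) (x := x) (y := y) (g.comp f)
      rwa [K.map_comp, L.map_comp] at h)
    (by
      rintro n _ _ ⟨f⟩
      change K.label (K.map f x) = L.label (L.map f y)
      funext i
      exact (f.dir i).elim0)

/-- The interpretation `□_S[0]` of `nil`. -/
noncomputable def nilP : PLSPS A where
  toLSPS := stdCube (fun i : Fin 0 => i.elim0)
  base := ⟨BoxHom.id 0⟩

/-- The unique map from the interpretation of `nil` to a pointed object, given by the initial
state. -/
noncomputable def fromNil (K : PLSPS A) : (nilP : PLSPS A) ⟶ K :=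
  PLSPS.Hom.mk ⟨fun x => K.map x.down K.base, fun f x => K.map_comp x.down f K.base,
    fun {n} x => by
      funext i
      exact (x.down.dir i).elim0⟩ (K.map_id K.base)

/-- The labelled `1`-cube `□_S[a]`, the interpretation of `a.nil`. -/
noncomputable def edge (a : A) : LSPS A := stdCube (fun _ : Fin 1 => a)

/-- The interpretation of `a.P`: the final state of `□_S[a]` is glued with the initial state of
the interpretation of `P`. The initial state is the initial state of `□_S[a]`. -/
noncomputable def prefixP (a : A) (K : PLSPS A) : PLSPS A where
  toLSPS := glue (edge a) K.toLSPS ⟨BoxHom.vertex fun _ => true⟩ K.base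
  base := Quot.mk _ (Sum.inl ⟨BoxHom.vertex fun _ => false⟩)

/-- The interpretation of `P + Q`, the coproduct of pointed objects: the initial states are
glued. -/
def sumP (K L : PLSPS A) : PLSPS A where
  toLSPS := glue K.toLSPS L.toLSPS K.base L.base
  base := Quot.mk _ (Sum.inl K.base)

/-- The interpretation of `(ν a)P`, the pullback of the interpretation of `P` along
`!^S (A \ {a, \bar a}) ⊂ !^S A`: the cubes none of whose labels is `a` or `\bar a`. -/
def restrictP (S : SyncLabels A) (a : { a : A // a ≠ S.tau }) (K : PLSPS A) : PLSPS A where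
  toLSPS := K.toLSPS.sub (fun x => ∀ i, K.label x i ≠ a ∧ K.label x i ≠ S.bar a)
    (fun f x h i => by
      rw [K.label_map]
      exact h (f.dir i))
  base := ⟨K.base, fun i => i.elim0⟩

/-- The interpretation of `P || Q`. -/
noncomputable def parP (S : SyncLabels A) (K L : PLSPS A) : PLSPS A where
  toLSPS := tensor S K.toLSPS L.toLSPS
  base := tensorState S K.toLSPS L.toLSPS K.base L.base

def glueMap {K L K' L' : LSPS A} {x : K.cube 0} {y : L.cube 0} {x' : K'.cube 0} {y' : L'.cube 0}
    (φ : LSPS.Hom K K') (ψ : LSPS.Hom L L') (hx : φ.app x = x') (hy : ψ.app y = y') :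
    LSPS.Hom (glue K L x y) (glue K' L' x' y') where
  app {k} := Quot.map (Sum.map φ.app ψ.app) (by
    rintro _ _ ⟨f⟩
    have h := GlueRel.mk (K := K') (L := L') (x := x') (y := y') f
    rw [← hx, ← hy, ← φ.app_map, ← ψ.app_map] at h
    subst hx hy
    exact h)
  app_map := by
    rintro m n f ⟨z | z⟩
    · exact congrArg (fun t => Quot.mk _ (Sum.inl t)) (φ.app_map f z)
    · exact congrArg (fun t => Quot.mk _ (Sum.inr t)) (ψ.app_map f z)
  label_app := by
    rintro n ⟨z | z⟩
    · exact φ.label_app z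
    · exact ψ.label_app z

theorem quot_sum_cases {α β : Type u} {r : α ⊕ β → α ⊕ β → Prop} {p : Quot r → Prop}
    (h1 : ∀ a, p (Quot.mk r (Sum.inl a))) (h2 : ∀ b, p (Quot.mk r (Sum.inr b))) (z) : p z := by
  rcases z with ⟨z | z⟩
  exacts [h1 z, h2 z]

noncomputable def prefixFunctor (a : A) : PLSPS A ⥤ PLSPS A where
  obj := prefixP a
  map φ := ⟨glueMap (LSPS.Hom.mk (fun x => x) (fun _ _ => rfl) (fun _ => rfl)) φ.toHom rfl
    φ.app_base, rfl⟩
  map_id _ := PLSPS.Hom.ext fun _ => quot_sum_cases (fun _ => rfl) (fun _ => rfl)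
  map_comp _ _ := PLSPS.Hom.ext fun _ => quot_sum_cases (fun _ => rfl) (fun _ => rfl)

def sumFunctor : PLSPS A × PLSPS A ⥤ PLSPS A where
  obj K := sumP K.1 K.2
  map φ := ⟨glueMap φ.1.toHom φ.2.toHom φ.1.app_base φ.2.app_base,
    congrArg (fun t => Quot.mk _ (Sum.inl t)) φ.1.app_base⟩
  map_id _ := PLSPS.Hom.ext fun _ => quot_sum_cases (fun _ => rfl) (fun _ => rfl)
  map_comp _ _ := PLSPS.Hom.ext fun _ => quot_sum_cases (fun _ => rfl) (fun _ => rfl)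

def restrictFunctor (S : SyncLabels A) (a : { a : A // a ≠ S.tau }) : PLSPS A ⥤ PLSPS A where
  obj := restrictP S a
  map φ := ⟨LSPS.Hom.mk (fun x => ⟨φ.app x.1, fun i => by rw [φ.label_app]; exact x.2 i⟩)
    (fun f x => Subtype.ext (φ.app_map f x.1)) (fun x => φ.label_app x.1),
    Subtype.ext φ.app_base⟩
  map_id _ := rfl
  map_comp _ _ := rfl

variable (S : SyncLabels A)

theorem syncCubeMap_id {m n k : ℕ} {a : Fin m → A} {b : Fin n → A} (ha : a = a ∘ (BoxHom.id m).dir)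
    (hb : b = b ∘ (BoxHom.id n).dir) (c : (syncCube S a b).cube k) :
    (syncCubeMap S (BoxHom.id m) (BoxHom.id n) ha hb).app c = c := by
  refine Subtype.ext (sigma_hom_ext rfl (fun _ => rfl) fun e => ?_)
  change (fiberedProductMap S (cubeGraphMap _ ha) (cubeGraphMap _ hb)).onE (c.1.2.onE e) = _
  generalize c.1.2.onE e = t
  rcases t with t | t | t <;> rfl

theorem syncCubeMap_comp {m n m' n' m'' n'' k : ℕ} {a : Fin m → A} {b : Fin n → A}
    {a' : Fin m' → A} {b' : Fin n' → A} {a'' : Fin m'' → A} {b'' : Fin n'' → A}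
    (f : BoxHom m m') (g : BoxHom n n') (f' : BoxHom m' m'') (g' : BoxHom n' n'')
    (ha : a = a' ∘ f.dir) (hb : b = b' ∘ g.dir) (ha' : a' = a'' ∘ f'.dir)
    (hb' : b' = b'' ∘ g'.dir) (ha'' : a = a'' ∘ (f'.comp f).dir) (hb'' : b = b'' ∘ (g'.comp g).dir)
    (c : (syncCube S a b).cube k) :
    (syncCubeMap S f' g' ha' hb').app ((syncCubeMap S f g ha hb).app c) =
      (syncCubeMap S (f'.comp f) (g'.comp g) ha'' hb'').app c := by
  refine Subtype.ext (sigma_hom_ext rfl (fun _ => rfl) fun e => ?_)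
  change (fiberedProductMap S (cubeGraphMap _ ha') (cubeGraphMap _ hb')).onE
      ((fiberedProductMap S (cubeGraphMap _ ha) (cubeGraphMap _ hb)).onE (c.1.2.onE e)) =
    (fiberedProductMap S (cubeGraphMap _ ha'') (cubeGraphMap _ hb'')).onE (c.1.2.onE e)
  generalize c.1.2.onE e = t
  rcases t with t | t | t <;> rfl

theorem eq_comp_dir_id {m : ℕ} {a b : Fin m → A} (h : a = b) : a = b ∘ (BoxHom.id m).dir := by
  subst h
  funext i
  simp

/-- A cube of a component of the disjoint union `preTensor`. -/
noncomputable def preTensorMk (K L : LSPS A) {m n k : ℕ} (x : K.cube m) (y : L.cube n)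
    (c : (syncCube S (K.label x) (L.label y)).cube k) : (preTensor S K L).cube k :=
  ⟨(⟨m, x⟩, ⟨n, y⟩), c⟩

theorem preTensorMk_congr (K L : LSPS A) {m n k : ℕ} {x x' : K.cube m} {y y' : L.cube n}
    (hx : x = x') (hy : y = y') (c : (syncCube S (K.label x) (L.label y)).cube k) :
    preTensorMk S K L x y c = preTensorMk S K L x' y'
      ((syncCubeMap S (BoxHom.id m) (BoxHom.id n) (eq_comp_dir_id (by rw [hx]))
        (eq_comp_dir_id (by rw [hy]))).app c) := by
  subst hx hy
  rw [syncCubeMap_id]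

noncomputable def preTensorMap {K L K' L' : LSPS A} (φ : LSPS.Hom K K') (ψ : LSPS.Hom L L')
    {k : ℕ} (z : (preTensor S K L).cube k) : (preTensor S K' L').cube k :=
  preTensorMk S K' L' (φ.app z.1.1.2) (ψ.app z.1.2.2)
    ((syncCubeMap S (BoxHom.id z.1.1.1) (BoxHom.id z.1.2.1)
      (eq_comp_dir_id (φ.label_app z.1.1.2).symm)
      (eq_comp_dir_id (ψ.label_app z.1.2.2).symm)).app z.2)

noncomputable def tensorMap {K L K' L' : LSPS A} (φ : LSPS.Hom K K') (ψ : LSPS.Hom L L') :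
    LSPS.Hom (tensor S K L) (tensor S K' L') where
  app := Quot.map (preTensorMap S φ ψ) (by
    rintro _ _ ⟨f, g, x, y, c⟩
    have h := TensorRel.mk (S := S) f g (φ.app x) (ψ.app y)
      ((syncCubeMap S (BoxHom.id _) (BoxHom.id _)
        (eq_comp_dir_id (by rw [← φ.app_map, φ.label_app]))
        (eq_comp_dir_id (by rw [← ψ.app_map, ψ.label_app]))).app c)
    have e := preTensorMk_congr S K' L' (φ.app_map f x) (ψ.app_map g y)
      ((syncCubeMap S (BoxHom.id _) (BoxHom.id _)
        (eq_comp_dir_id (φ.label_app _).symm) (eq_comp_dir_id (ψ.label_app _).symm)).app c)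
    rw [syncCubeMap_comp S _ _ _ _ _ _ _ _ (eq_comp_dir_id (by rw [← φ.app_map, φ.label_app]))
      (eq_comp_dir_id (by rw [← ψ.app_map, ψ.label_app]))] at e
    have e' : preTensorMap S φ ψ ⟨(⟨_, x⟩, ⟨_, y⟩),
        (syncCubeMap S f g (K.label_map f x) (L.label_map g y)).app c⟩ =
        preTensorMk S K' L' (φ.app x) (ψ.app y)
          ((syncCubeMap S f g (K'.label_map f _) (L'.label_map g _)).app
            ((syncCubeMap S (BoxHom.id _) (BoxHom.id _)
              (eq_comp_dir_id (by rw [← φ.app_map, φ.label_app]))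
              (eq_comp_dir_id (by rw [← ψ.app_map, ψ.label_app]))).app c)) := by
      refine congrArg (preTensorMk S K' L' (φ.app x) (ψ.app y)) ?_
      have hf : K.label (K.map f x) = K'.label (φ.app x) ∘ f.dir := by
        rw [φ.label_app, K.label_map]
      have hg : L.label (L.map g y) = L'.label (ψ.app y) ∘ g.dir := by
        rw [ψ.label_app, L.label_map]
      rw [syncCubeMap_comp S f g (BoxHom.id _) (BoxHom.id _) _ _ _ _ hf hg,
        syncCubeMap_comp S (BoxHom.id _) (BoxHom.id _) f g _ _ _ _ hf hg]
      rfl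
    rw [e']
    exact (congrArg (fun t => TensorRel S K' L' t _) e).mpr h)
  app_map := by
    rintro m n f ⟨z⟩
    rfl
  label_app := by
    rintro n ⟨z⟩
    rfl

noncomputable def parFunctor : PLSPS A × PLSPS A ⥤ PLSPS A where
  obj K := parP S K.1 K.2
  map {K L} φ := ⟨tensorMap S φ.1.toHom φ.2.toHom, by
    have h : ∀ (x : L.1.cube 0) (y : L.2.cube 0) (_ : φ.1.app K.1.base = x)
        (_ : φ.2.app K.2.base = y), (tensorMap S φ.1.toHom φ.2.toHom).app (parP S K.1 K.2).base =
          tensorState S L.1.toLSPS L.2.toLSPS x y := by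
      rintro _ _ rfl rfl
      refine congrArg (fun t => Quot.mk _
        (preTensorMk S _ _ (φ.1.app K.1.base) (φ.2.app K.2.base) t)) ?_
      refine Subtype.ext (sigma_hom_ext rfl (fun _ => ?_) fun e => absurd e.dim_le (by decide))
      exact Prod.ext (funext fun i => i.elim0) (funext fun i => i.elim0)
    exact h _ _ φ.1.app_base φ.2.app_base⟩
  map_id K := PLSPS.Hom.ext fun n => by
    rintro ⟨z⟩
    exact congrArg (fun t => Quot.mk _ (preTensorMk S _ _ z.1.1.2 z.1.2.2 t))
      (syncCubeMap_id S _ _ z.2)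
  map_comp {K L M} φ ψ := PLSPS.Hom.ext fun n => by
    rintro ⟨z⟩
    refine congrArg (fun t => Quot.mk _ (preTensorMk S _ _ (ψ.1.app (φ.1.app z.1.1.2))
      (ψ.2.app (φ.2.app z.1.2.2)) t)) ?_
    exact (syncCubeMap_comp S (BoxHom.id _) (BoxHom.id _) (BoxHom.id _) (BoxHom.id _)
      _ _ _ _ _ _ z.2).symm

end Operations

/-! ## Recursion -/

section Recursion

variable {A : Type u}

inductive SeqRel (X : ℕ → PLSPS A) (s : ∀ k, X k ⟶ X (k + 1)) {n : ℕ} :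
    (LSPS.sigma fun k : ULift.{u} ℕ => (X k.down).toLSPS).cube n →
    (LSPS.sigma fun k : ULift.{u} ℕ => (X k.down).toLSPS).cube n → Prop
  | mk (k : ℕ) (x : (X k).cube n) : SeqRel X s ⟨⟨k⟩, x⟩ ⟨⟨k + 1⟩, (s k).app x⟩

/-- The colimit of a sequence `X 0 → X 1 → X 2 → ⋯`. -/
def seqColim (X : ℕ → PLSPS A) (s : ∀ k, X k ⟶ X (k + 1)) : PLSPS A where
  toLSPS := (LSPS.sigma fun k : ULift.{u} ℕ => (X k.down).toLSPS).quot (SeqRel X s)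
    (by
      rintro m n f _ _ ⟨k, x⟩
      have h := SeqRel.mk (s := s) k ((X k).map f x)
      rwa [(s k).app_map] at h)
    (by
      rintro n _ _ ⟨k, x⟩
      exact ((s k).label_app x).symm)
  base := Quot.mk _ ⟨⟨0⟩, (X 0).base⟩

/-- The canonical map from a term of the sequence to the colimit. -/
def seqIn {X : ℕ → PLSPS A} (s : ∀ k, X k ⟶ X (k + 1)) (k : ℕ) {n : ℕ} (x : (X k).cube n) :
    (seqColim X s).cube n := Quot.mk _ ⟨⟨k⟩, x⟩

def seqColimMap {X Y : ℕ → PLSPS A} {s : ∀ k, X k ⟶ X (k + 1)} {t : ∀ k, Y k ⟶ Y (k + 1)}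
    (φ : ∀ k, X k ⟶ Y k) (hφ : ∀ k, s k ≫ φ (k + 1) = φ k ≫ t k) :
    seqColim X s ⟶ seqColim Y t :=
  PLSPS.Hom.mk
    { app := Quot.map (fun z => ⟨z.1, (φ z.1.down).app z.2⟩) (by
        rintro _ _ ⟨k, x⟩
        have h := SeqRel.mk (s := t) k ((φ k).app x)
        have e : (t k).app ((φ k).app x) = (φ (k + 1)).app ((s k).app x) :=
          congrArg (fun θ : X k ⟶ Y (k + 1) => θ.app x) (hφ k).symm
        rwa [e] at h)
      app_map := by
        rintro m n f ⟨z⟩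
        exact congrArg (seqIn t z.1.down) ((φ z.1.down).app_map f z.2)
      label_app := by
        rintro n ⟨z⟩
        exact (φ z.1.down).label_app z.2 }
    (congrArg (seqIn t 0) (φ 0).app_base)

theorem fromNil_comp {K L : PLSPS A} (φ : K ⟶ L) : fromNil K ≫ φ = fromNil L :=
  PLSPS.Hom.ext fun n x => by
    have h := φ.app_map x.down K.base
    rw [φ.app_base] at h
    exact h

variable {n : ℕ}

def consObj (X : PLSPS A) (ρ : Fin n → PLSPS A) : Fin (n + 1) → PLSPS A :=
  Fin.cons (α := fun _ => PLSPS A) X ρ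

def consMap {X Y : PLSPS A} {ρ ρ' : Fin n → PLSPS A} (f : X ⟶ Y) (g : ρ ⟶ ρ') :
    consObj X ρ ⟶ consObj Y ρ' :=
  fun i => Fin.cases (motive := fun i => consObj X ρ i ⟶ consObj Y ρ' i) f g i

theorem consMap_comp {X Y Z : PLSPS A} {ρ ρ' ρ'' : Fin n → PLSPS A} (f : X ⟶ Y) (f' : Y ⟶ Z)
    (g : ρ ⟶ ρ') (g' : ρ' ⟶ ρ'') :
    consMap f g ≫ consMap f' g' = consMap (f ≫ f') (g ≫ g') := by
  funext i
  refine Fin.cases ?_ (fun i => ?_) i <;> rfl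

theorem consMap_id (X : PLSPS A) (ρ : Fin n → PLSPS A) :
    consMap (𝟙 X) (𝟙 ρ) = 𝟙 (consObj X ρ) := by
  funext i
  refine Fin.cases ?_ (fun i => ?_) i <;> rfl

variable (F : (Fin (n + 1) → PLSPS A) ⥤ PLSPS A)

/-- The iterates `nil, F(nil), F(F(nil)), …` of `F(-, ρ)`. -/
noncomputable def iter (ρ : Fin n → PLSPS A) : ℕ → PLSPS A
  | 0 => nilP
  | k + 1 => F.obj (consObj (iter ρ k) ρ)

/-- The canonical maps between the iterates, starting from the map `nil → F(nil)` given by the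
initial state. -/
noncomputable def iterStep (ρ : Fin n → PLSPS A) : ∀ k, iter F ρ k ⟶ iter F ρ (k + 1)
  | 0 => fromNil _
  | k + 1 => F.map (consMap (iterStep ρ k) (𝟙 ρ))

noncomputable def iterMap {ρ ρ' : Fin n → PLSPS A} (g : ρ ⟶ ρ') : ∀ k, iter F ρ k ⟶ iter F ρ' k
  | 0 => 𝟙 _
  | k + 1 => F.map (consMap (iterMap g k) g)

theorem iterStep_iterMap {ρ ρ' : Fin n → PLSPS A} (g : ρ ⟶ ρ') (k : ℕ) :
    iterStep F ρ k ≫ iterMap F g (k + 1) = iterMap F g k ≫ iterStep F ρ' k := by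
  induction k with
  | zero =>
    have h : iterMap F g 0 ≫ iterStep F ρ' 0 = fromNil _ := Category.id_comp _
    rw [h]
    exact fromNil_comp _
  | succ k ih =>
    change F.map (consMap (iterStep F ρ k) (𝟙 ρ)) ≫ F.map (consMap (iterMap F g (k + 1)) g) =
      F.map (consMap (iterMap F g k) g) ≫ F.map (consMap (iterStep F ρ' k) (𝟙 ρ'))
    rw [← F.map_comp, ← F.map_comp, consMap_comp, consMap_comp, ih, Category.id_comp,
      Category.comp_id]

theorem iterMap_id (ρ : Fin n → PLSPS A) (k : ℕ) : iterMap F (𝟙 ρ) k = 𝟙 _ := by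
  induction k with
  | zero => rfl
  | succ k ih =>
    change F.map (consMap (iterMap F (𝟙 ρ) k) (𝟙 ρ)) = _
    rw [ih, consMap_id, F.map_id]
    rfl

theorem iterMap_comp {ρ ρ' ρ'' : Fin n → PLSPS A} (g : ρ ⟶ ρ') (g' : ρ' ⟶ ρ'') (k : ℕ) :
    iterMap F (g ≫ g') k = iterMap F g k ≫ iterMap F g' k := by
  induction k with
  | zero => rfl
  | succ k ih =>
    change F.map (consMap (iterMap F (g ≫ g') k) (g ≫ g')) =
      F.map (consMap (iterMap F g k) g) ≫ F.map (consMap (iterMap F g' k) g')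
    rw [ih, ← F.map_comp, consMap_comp]

/-- The least fixed point of `X ↦ F(X, ρ)`: the colimit of the iterates `F^k(nil)`, as a functor
of the parameters `ρ`. -/
noncomputable def fixFunctor : (Fin n → PLSPS A) ⥤ PLSPS A where
  obj ρ := seqColim (iter F ρ) (iterStep F ρ)
  map g := seqColimMap (iterMap F g) (iterStep_iterMap F g)
  map_id ρ := PLSPS.Hom.ext fun m => by
    rintro ⟨⟨k, x⟩⟩
    exact congrArg (fun θ : iter F ρ k.down ⟶ iter F ρ k.down => seqIn (iterStep F ρ) k.down (θ.app x))
      (iterMap_id F ρ k.down)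
  map_comp {ρ ρ' ρ''} g g' := PLSPS.Hom.ext fun m => by
    rintro ⟨⟨k, x⟩⟩
    exact congrArg (fun θ : iter F ρ k.down ⟶ iter F ρ'' k.down => seqIn (iterStep F ρ'') k.down (θ.app x))
      (iterMap_comp F g g' k.down)

end Recursion

/-! ## CCS process names and their interpretation -/

/-- CCS terms with free variables among `x_0, …, x_{n-1}`. In `fix P`, which stands for
`rec(x)P(x)`, the bound variable `x` is the variable `x_0` of `P`, and `x_1, x_2, …` are the other
free variables. -/
inductive Term {A : Type u} (S : SyncLabels A) : ℕ → Type u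
  | var {n : ℕ} (i : Fin n) : Term S n
  | nil {n : ℕ} : Term S n
  | pre {n : ℕ} (a : A) (P : Term S n) : Term S n
  | nu {n : ℕ} (a : { a : A // a ≠ S.tau }) (P : Term S n) : Term S n
  | add {n : ℕ} (P Q : Term S n) : Term S n
  | par {n : ℕ} (P Q : Term S n) : Term S n
  | fix {n : ℕ} (P : Term S (n + 1)) : Term S n

namespace Term

variable {A : Type u} {S : SyncLabels A}

/-- The variable `x_i` is guarded in the term: each of its occurrences lies in a prefix term. -/
def GuardedAt : ∀ {n : ℕ}, Term S n → Fin n → Prop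
  | _, var j, i => i ≠ j
  | _, nil, _ => True
  | _, pre _ _, _ => True
  | _, nu _ P, i => P.GuardedAt i
  | _, add P Q, i => P.GuardedAt i ∧ Q.GuardedAt i
  | _, par P Q, i => P.GuardedAt i ∧ Q.GuardedAt i
  | _, fix P, i => P.GuardedAt i.succ

/-- In every subterm `rec(x)P(x)`, the variable `x` is guarded. -/
def WellGuarded : ∀ {n : ℕ}, Term S n → Prop
  | _, var _ => True
  | _, nil => True
  | _, pre _ P => P.WellGuarded
  | _, nu _ P => P.WellGuarded
  | _, add P Q => P.WellGuarded ∧ Q.WellGuarded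
  | _, par P Q => P.WellGuarded ∧ Q.WellGuarded
  | _, fix P => P.GuardedAt 0 ∧ P.WellGuarded

/-- The interpretation of a term with `n` free variables, as a functor of the interpretations of
these variables. -/
noncomputable def sem : ∀ {n : ℕ}, Term S n → ((Fin n → PLSPS A) ⥤ PLSPS A)
  | _, var i => Pi.eval (fun _ => PLSPS A) i
  | _, nil => (Functor.const _).obj nilP
  | _, pre a P => P.sem ⋙ prefixFunctor a
  | _, nu a P => P.sem ⋙ restrictFunctor S a
  | _, add P Q => Functor.prod' P.sem Q.sem ⋙ sumFunctor
  | _, par P Q => Functor.prod' P.sem Q.sem ⋙ parFunctor S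
  | _, fix P => fixFunctor P.sem

end Term

/-- The CCS process names: the closed terms all of whose recursions are guarded. -/
def ProcName {A : Type u} (S : SyncLabels A) : Type u := { P : Term S 0 // P.WellGuarded }

/-- The labelled symmetric precubical set `□_S⟦P⟧` with its initial state. -/
noncomputable def ProcName.interp {A : Type u} {S : SyncLabels A} (P : ProcName S) : PLSPS A :=
  P.1.sem.obj (fun i => i.elim0)

end CCS

/-! The proof isolates a property of a labelled symmetric precubical set, `Regular`, which implies
all the conclusions and is inherited along the constructions of CCS. It asks that a cube be
determined by its vertices, that no edge be a loop, that the directions of a cube give distinct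
actions of the realization, and that the source of a cube and its set of actions determine its
target.

Regularity gives the conclusions as follows. The vertices of a `p`-cube with `p ≥ 2` lie in its
boundary, so a filler is determined by the shell. The determinism clause shows that the transitions
coming from cubes are already closed under Coherence: the intermediate states are forced to be
vertices of the cube carrying the long transition, and the required transition is a face of that
cube. Hence each transition of the realization is a cube (`Regular.cubeTrans_of_rTr`). CSA1 follows
because an edge is determined by its two ends, and the Unique intermediate state axiom follows from
determinism inside one cube. CSA2 and CSA3 are formal consequences of the latter, by Multiset and
Coherence.

Regularity is proved by induction on terms. The actions of a realization form a colimit that is hard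
to compute; `Regular.of_events` replaces them by any compatible family of "events" which is fine
enough. The main case is the tensor product. Every cube of it has a normal form, a cube of each
factor together with increasing maps saying which directions it moves (`exists_syncCube_lift`,
`exists_tensorRep`), and this form is recovered from the vertices (`tensor_ext`). For recursion,
regularity passes to colimits of sequences of maps which are injective on states
(`Regular.seqColim`). The induction hypothesis therefore concerns functors, and also records that
injectivity on states is preserved (`PreservesRegular`). -/

namespace CCS

/-! ### Faces and axes of the standard cubes. -/

namespace BoxHom

/-- A map all of whose coordinates are constants or coordinates of the argument, each coordinate
of the argument being used exactly once, is a morphism of `□_S`. -/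
def ofCoord {m n : ℕ} (h : Fin n → Fin m ⊕ Bool) (hh : ∀ i, ∃! j, h j = Sum.inl i) :
    BoxHom m n where
  toFun x j := Sum.elim x (fun b => b) (h j)
  strictMono := by
    refine Monotone.strictMono_of_injective (fun x y hxy j => ?_) fun x y hxy => funext fun i => ?_
    · cases hj : h j with
      | inl i => simpa [hj] using hxy i
      | inr b => simp
    · obtain ⟨j, hj, -⟩ := hh i
      simpa [hj] using congrFun hxy j
  adj x y hxy := by
    rw [hammingDist, Finset.card_eq_one] at hxy ⊢
    obtain ⟨i, hi⟩ := hxy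
    have hi' : ∀ l, x l ≠ y l ↔ l = i := fun l => by simpa using Finset.ext_iff.1 hi l
    obtain ⟨j, hj, hu⟩ := hh i
    refine ⟨j, Finset.ext fun l => ?_⟩
    rw [Finset.mem_filter, Finset.mem_singleton]
    constructor
    · rintro ⟨-, hl⟩
      refine hu l ?_
      cases hl' : h l with
      | inl i' =>
        rw [hl'] at hl
        rw [hl', (hi' i').1 hl]
      | inr b => simp [hl'] at hl
    · rintro rfl
      exact ⟨Finset.mem_univ _, by simpa [hj] using (hi' i).2 rfl⟩
  inj x y hxy := funext fun i => by
    obtain ⟨j, hj, -⟩ := hh i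
    simpa [hj] using congrFun hxy j

theorem ofCoord_apply {m n : ℕ} (h : Fin n → Fin m ⊕ Bool) (hh : ∀ i, ∃! j, h j = Sum.inl i)
    (x : Vtx m) (j : Fin n) : ofCoord h hh x j = Sum.elim x (fun b => b) (h j) := rfl

theorem ofCoord_dir {m n : ℕ} (h : Fin n → Fin m ⊕ Bool) (hh : ∀ i, ∃! j, h j = Sum.inl i)
    (i : Fin m) (j : Fin n) (hj : h j = Sum.inl i) : (ofCoord h hh).dir i = j := by
  refine dir_unique _ i (fun _ => false) j rfl (by simp [ofCoord_apply, hj]) (funext fun l => ?_)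
  by_cases hl : l = j
  · subst hl
    simp [ofCoord_apply, hj]
  · rw [Function.update_of_ne hl, ofCoord_apply, ofCoord_apply]
    cases hl' : h l with
    | inl i' =>
      have : i' ≠ i := by
        rintro rfl
        exact hl ((hh i').unique hl' hj)
      simp [this]
    | inr b => rfl

/-- The edge of the `n`-cube starting from the initial vertex in the direction `i`. -/
def axis {n : ℕ} (i : Fin n) : BoxHom 1 n :=
  ofCoord (fun j => if j = i then Sum.inl 0 else Sum.inr false)
    (fun l => ⟨i, by simp [Subsingleton.elim l 0], fun j hj => by
      by_contra hne
      simp [hne] at hj⟩)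

/-- The coordinates of the face of the `n`-cube whose directions are the elements of the list `l`,
the other coordinates being those of `v`. -/
def faceCoord {n : ℕ} (l : List (Fin n)) (v : Vtx n) (j : Fin n) : Fin l.length ⊕ Bool :=
  if h : l.idxOf j < l.length then Sum.inl ⟨l.idxOf j, h⟩ else Sum.inr (v j)

theorem faceCoord_get {n : ℕ} {l : List (Fin n)} (hl : l.Nodup) (v : Vtx n) (i : Fin l.length) :
    faceCoord l v (l.get i) = Sum.inl i := by
  have e : l.idxOf (l.get i) = i := List.Nodup.idxOf_getElem hl i i.2
  rw [faceCoord, dif_pos (e ▸ i.2)]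
  exact congrArg Sum.inl (Fin.ext e)

theorem faceCoord_existsUnique {n : ℕ} {l : List (Fin n)} (hl : l.Nodup) (v : Vtx n)
    (i : Fin l.length) : ∃! j, faceCoord l v j = Sum.inl i := by
  refine ⟨l.get i, faceCoord_get hl v i, fun j hj => ?_⟩
  beta_reduce at hj
  rw [faceCoord] at hj
  split_ifs at hj with h
  rw [← Sum.inl.inj hj]
  simp

/-- The face of the `n`-cube whose directions are the elements of the list `l`, the other
coordinates being those of `v`. -/
def face {n : ℕ} (l : List (Fin n)) (hl : l.Nodup) (v : Vtx n) : BoxHom l.length n :=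
  ofCoord (faceCoord l v) (faceCoord_existsUnique hl v)

theorem face_dir {n : ℕ} (l : List (Fin n)) (hl : l.Nodup) (v : Vtx n) (i : Fin l.length) :
    (face l hl v).dir i = l.get i :=
  ofCoord_dir _ _ i _ (faceCoord_get hl v i)

theorem face_apply_of_mem {n : ℕ} (l : List (Fin n)) (hl : l.Nodup) (v : Vtx n) (b : Bool)
    {j : Fin n} (hj : j ∈ l) : face l hl v (fun _ => b) j = b := by
  rw [face, ofCoord_apply, faceCoord, dif_pos (List.idxOf_lt_length_iff.2 hj), Sum.elim_inl]

theorem face_apply_of_notMem {n : ℕ} (l : List (Fin n)) (hl : l.Nodup) (v : Vtx n)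
    (x : Vtx l.length) {j : Fin n} (hj : j ∉ l) : face l hl v x j = v j := by
  rw [face, ofCoord_apply, faceCoord, dif_neg (fun h => hj (List.idxOf_lt_length_iff.1 h)),
    Sum.elim_inr]

theorem eq_id_of_zero (f : BoxHom 0 0) : f = BoxHom.id 0 :=
  ext fun _ => Subsingleton.elim _ _

/-- The coordinates where the images differ are the images under `f.dir` of those where the
arguments differ, and `f.dir` is injective. -/
theorem hammingDist_apply {m n : ℕ} (f : BoxHom m n) (x y : Vtx m) :
    hammingDist (f x) (f y) = hammingDist x y := by
  classical
  rw [hammingDist, hammingDist, ← Finset.card_image_of_injective _ f.dir_injective]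
  congr 1
  ext k
  simp only [Finset.mem_filter, Finset.mem_univ, true_and, Finset.mem_image]
  constructor
  · intro hk
    by_cases h : ∃ i, f.dir i = k
    · obtain ⟨i, rfl⟩ := h
      rw [f.apply_dir, f.apply_dir] at hk
      exact ⟨i, hk, rfl⟩
    · have h' : ∀ i, f.dir i ≠ k := fun i hi => h ⟨i, hi⟩
      rw [f.apply_not_dir k h' x, f.apply_not_dir k h' y] at hk
      exact absurd rfl hk
  · rintro ⟨i, hi, rfl⟩
    rwa [f.apply_dir, f.apply_dir]

end BoxHom

/-! ### Vertices of cubes. -/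

namespace LSPS

variable {A : Type u} (K : LSPS A)

/-- The vertex `v` of the cube `x`. -/
def vtx {n : ℕ} (x : K.cube n) (v : Vtx n) : K.cube 0 := K.map (BoxHom.vertex v) x

/-- The initial vertex of a cube. -/
def source {n : ℕ} (x : K.cube n) : K.cube 0 := K.vtx x fun _ => false

/-- The final vertex of a cube. -/
def target {n : ℕ} (x : K.cube n) : K.cube 0 := K.vtx x fun _ => true

theorem vtx_map {m n : ℕ} (f : BoxHom m n) (x : K.cube n) (v : Vtx m) :
    K.vtx (K.map f x) v = K.vtx x (f v) :=
  (K.map_comp f (BoxHom.vertex v) x).symm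

theorem map_zero (f : BoxHom 0 0) (x : K.cube 0) : K.map f x = x := by
  rw [f.eq_id_of_zero, K.map_id]

theorem vtx_zero (x : K.cube 0) (v : Vtx 0) : K.vtx x v = x := K.map_zero _ x

end LSPS

theorem LSPS.Hom.app_vtx {A : Type u} {K L : LSPS A} (φ : LSPS.Hom K L) {n : ℕ} (x : K.cube n)
    (v : Vtx n) : φ.app (K.vtx x v) = L.vtx (φ.app x) v :=
  φ.app_map _ x

/-! ### Regular sets and the transitions of their realizations. -/

section Realization

variable {A : Type u} {K : LSPS A}

theorem rAction_map {m n : ℕ} (f : BoxHom m n) (x : K.cube n) (i : Fin m) :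
    rAction K (K.map f x) i = rAction K x (f.dir i) :=
  Quot.sound (ActionRel.mk f x i)

theorem rState_map {m n : ℕ} (f : BoxHom m n) (x : K.cube n) (v : Vtx m) :
    rState K (K.map f x) v = rState K x (f v) :=
  Quot.sound (StateRel.mk f x v)

/-- The states of the realization are the `0`-cubes. -/
def RState.toVertex : RState K → K.cube 0 :=
  Quot.lift (fun p => K.vtx p.2.1 p.2.2) (by
    rintro _ _ ⟨f, x, v⟩
    exact K.vtx_map f x v)

theorem rState_inj {m n : ℕ} {x : K.cube m} {y : K.cube n} {v : Vtx m} {w : Vtx n} :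
    rState K x v = rState K y w ↔ K.vtx x v = K.vtx y w := by
  refine ⟨fun h => congrArg RState.toVertex h, fun h => ?_⟩
  -- Every pair of a cube and a vertex is identified with a `0`-cube, its canonical representative.
  have e : ∀ {m : ℕ} (x : K.cube m) (v : Vtx m),
      rState K (K.vtx x v) (fun i => i.elim0) = rState K x v := fun x v => rState_map _ x _
  rw [← e x v, h, e y w]

/-- A map from the actions of the realization, given by a map on the directions of the cubes. -/
def RAction.lift {E : Type*} (ev : ∀ {n : ℕ}, K.cube n → Fin n → E)
    (hev : ∀ {m n : ℕ} (f : BoxHom m n) (x : K.cube n) (i : Fin m),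
      ev (K.map f x) i = ev x (f.dir i)) : RAction K → E :=
  Quot.lift (fun p => ev p.2.1 p.2.2) (by
    rintro _ _ ⟨f, x, i⟩
    exact hev f x i)

/-- The map induced by a morphism on the actions of the realizations. -/
def RAction.map {L : LSPS A} (φ : LSPS.Hom K L) : RAction K → RAction L :=
  RAction.lift (fun x i => rAction L (φ.app x) i)
    (fun f x i => by rw [φ.app_map, rAction_map])

variable (K) in
/-- The invariant of the interpretations of processes: the cubes are determined by their vertices,
there are no loops, the actions of a cube are distinct, and the final state of a cube is
determined by its initial state and its actions. -/
structure Regular : Prop where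
  vertex_ext : ∀ {n : ℕ} (x y : K.cube n), (∀ v, K.vtx x v = K.vtx y v) → x = y
  no_loop : ∀ x : K.cube 1, K.source x ≠ K.target x
  action_injective : ∀ {n : ℕ} (x : K.cube n), Function.Injective (rAction K x)
  det : ∀ {m n : ℕ} (x : K.cube m) (y : K.cube n), K.source x = K.source y →
    Set.range (rAction K x) = Set.range (rAction K y) → K.target x = K.target y

/-- A family compatible with the maps of `□_S` factors through the actions of the realization, which
form a colimit. So injectivity of `ev` gives injectivity of `rAction`, and equal sets of actions
give equal sets of events. This avoids computing the actions of each construction. -/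
theorem Regular.of_events {E : Type*} (ev : ∀ {n : ℕ}, K.cube n → Fin n → E)
    (hev : ∀ {m n : ℕ} (f : BoxHom m n) (x : K.cube n) (i : Fin m),
      ev (K.map f x) i = ev x (f.dir i))
    (h1 : ∀ {n : ℕ} (x y : K.cube n), (∀ v, K.vtx x v = K.vtx y v) → x = y)
    (h2 : ∀ x : K.cube 1, K.source x ≠ K.target x)
    (h3 : ∀ {n : ℕ} (x : K.cube n), Function.Injective (ev x))
    (h4 : ∀ {m n : ℕ} (x : K.cube m) (y : K.cube n), K.source x = K.source y →
      Set.range (ev x) = Set.range (ev y) → K.target x = K.target y) : Regular K where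
  vertex_ext := h1
  no_loop := h2
  action_injective x i j h := h3 x (congrArg (RAction.lift ev hev) h)
  det x y hs hr := h4 x y hs (by
    have h := congrArg (Set.image (RAction.lift ev hev)) hr
    rwa [← Set.range_comp, ← Set.range_comp] at h)

theorem Regular.app_injective {L : LSPS A} (hK : Regular K) (φ : LSPS.Hom K L)
    (hφ : Function.Injective (φ.app (n := 0))) (n : ℕ) : Function.Injective (φ.app (n := n)) :=
  fun x y h => hK.vertex_ext x y fun v => hφ (by rw [φ.app_vtx, φ.app_vtx, h])

/-- Two fillers agree on the vertices, which belong to the boundary because `p > 0`, and vertices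
determine cubes. -/
theorem Regular.hdaParadigm (hK : Regular K) : HDAParadigm K := by
  intro p hp a s k k' hk hk'
  refine LSPS.Hom.ext fun n x => hK.vertex_ext _ _ fun v => ?_
  have h : boundaryIncl a ≫ k = boundaryIncl a ≫ k' := hk.trans hk'.symm
  have e := congrArg (fun θ : LSPS.Hom (stdBoundary a) K =>
    θ.app (n := 0) ⟨(stdCube a).vtx x v, by change 0 < p; omega⟩) h
  change k.app ((stdCube a).vtx x v) = k'.app ((stdCube a).vtx x v) at e
  rwa [k.app_vtx, k'.app_vtx] at e

variable (K) in
/-- The transitions given by the cubes. -/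
def CubeTrans (α : RState K) (l : List (RAction K)) (β : RState K) : Prop :=
  ∃ (n : ℕ) (x : K.cube n), 0 < n ∧ α = rState K x (fun _ => false) ∧
    β = rState K x (fun _ => true) ∧ l.Perm (List.ofFn (rAction K x))

/-- The face with directions `l` through `v` has source `v` and target `w`, so the transition is the
full diagonal of that face. -/
theorem CubeTr.cubeTrans {n : ℕ} {v w : Vtx n} {l : List (Fin n)} (h : CubeTr v l w)
    (x : K.cube n) :
    CubeTrans K (rState K x v) (l.map (rAction K x)) (rState K x w) := by
  obtain ⟨h1, h2, h3, h4⟩ := h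
  refine ⟨l.length, K.map (BoxHom.face l h2 v) x, List.length_pos_iff.2 h1, ?_, ?_, ?_⟩
  · rw [rState_map]
    congr 1
    funext j
    by_cases hj : j ∈ l
    · rw [BoxHom.face_apply_of_mem _ _ _ _ hj]
      have h := h3 j
      have h' := (h4 j).2 hj
      revert h h'
      cases v j <;> cases w j <;> simp
    · rw [BoxHom.face_apply_of_notMem _ _ _ _ hj]
  · rw [rState_map]
    congr 1
    funext j
    by_cases hj : j ∈ l
    · rw [BoxHom.face_apply_of_mem _ _ _ _ hj]
      have h := h3 j
      have h' := (h4 j).2 hj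
      revert h h'
      cases v j <;> cases w j <;> simp
    · rw [BoxHom.face_apply_of_notMem _ _ _ _ hj]
      exact (not_not.1 (mt (h4 j).1 hj)).symm
  · have e : rAction K (K.map (BoxHom.face l h2 v) x) = rAction K x ∘ l.get := by
      funext i
      rw [rAction_map, BoxHom.face_dir]
      rfl
    rw [e, ← List.map_ofFn, List.ofFn_get]

/-- The vertex of the `n`-cube with the coordinate `1` in the directions of the list `l`. -/
def listVtx {n : ℕ} (l : List (Fin n)) : Vtx n := fun i => decide (i ∈ l)

theorem cubeTr_listVtx {n : ℕ} {l l' : List (Fin n)} (h : (l ++ l').Nodup) (h' : l' ≠ []) :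
    CubeTr (listVtx l) l' (listVtx (l ++ l')) := by
  obtain ⟨-, h2, h3⟩ := List.nodup_append.1 h
  refine ⟨h', h2, fun i hi => ?_, fun i => ?_⟩
  · simp only [listVtx, decide_eq_true_eq, List.mem_append] at hi ⊢
    exact Or.inl hi
  · have := fun hi hi' => h3 i hi i hi' rfl
    simp only [listVtx, ne_eq, decide_eq_decide, List.mem_append]
    tauto

theorem listVtx_nil (n : ℕ) : listVtx ([] : List (Fin n)) = fun _ => false := by
  funext i
  simp [listVtx]

theorem listVtx_eq_true {n : ℕ} {l : List (Fin n)} (hl : l.Perm (List.finRange n)) :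
    listVtx l = fun _ => true := by
  funext i
  simp [listVtx, hl.mem_iff]

theorem Regular.exists_indices (hK : Regular K) {n : ℕ} {x : K.cube n} {l : List (RAction K)}
    (h : l.Perm (List.ofFn (rAction K x))) :
    ∃ L : List (Fin n), L.Perm (List.finRange n) ∧ l = L.map (rAction K x) := by
  have h' : l ∈ Set.range (List.map (rAction K x)) := by
    rw [Set.range_list_map]
    intro u hu
    exact (List.mem_ofFn' _ _).1 (h.mem_iff.1 hu)
  obtain ⟨L, rfl⟩ := h'
  rw [List.ofFn_eq_map, List.map_perm_map_iff (hK.action_injective x)] at h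
  exact ⟨L, h, rfl⟩

/-- The face of `x` with directions `L` and the given cube share their source and their actions, so
determinism identifies their targets. This confines intermediate states to the vertices of `x`. -/
theorem Regular.cubeTrans_eq (hK : Regular K) {n : ℕ} {x : K.cube n} {L : List (Fin n)}
    (hL : L.Nodup) (hL' : L ≠ []) {ν : RState K}
    (h : CubeTrans K (rState K x fun _ => false) (L.map (rAction K x)) ν) :
    ν = rState K x (listVtx L) := by
  have h0 := (cubeTr_listVtx (l := []) (l' := L) hL hL').cubeTrans x
  rw [listVtx_nil] at h0
  obtain ⟨m, y, -, hy, rfl, hp⟩ := h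
  obtain ⟨m', z, -, hz, hz', hp'⟩ := h0
  refine Eq.trans ?_ hz'.symm
  rw [rState_inj]
  refine hK.det y z (rState_inj.1 (hy.symm.trans hz)) (Set.ext fun u => ?_)
  rw [← List.mem_ofFn', ← List.mem_ofFn', ← hp.mem_iff, ← hp'.mem_iff]

/-- The cube transitions are closed under Coherence, so the closure defining `RTr` adds nothing to
them. -/
theorem Regular.cubeTrans_of_rTr (hK : Regular K) {α β : RState K} {l : List (RAction K)}
    (h : RTr K α l β) : CubeTrans K α l β := by
  induction h with
  | cube x v w l h => exact h.cubeTrans x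
  | multiset hl _ ih =>
    obtain ⟨n, x, hn, h1, h2, h3⟩ := ih
    exact ⟨n, x, hn, h1, h2, hl.symm.trans h3⟩
  | coherence hl₁ hl₂ hl₃ _ _ _ _ _ ih1 ih2 _ ih4 _ =>
    obtain ⟨n, x, hn, rfl, rfl, h3⟩ := ih1
    obtain ⟨L, hL, e⟩ := hK.exists_indices h3
    obtain ⟨L', L₃, rfl, e', rfl⟩ := List.map_eq_append_iff.1 e.symm
    obtain ⟨L₁, L₂, rfl, rfl, rfl⟩ := List.map_eq_append_iff.1 e'
    have hn := hL.nodup_iff.2 (List.nodup_finRange n)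
    have hn' := (List.nodup_append.1 hn).1
    rw [← List.map_append] at ih4
    have hne : L₁ ≠ [] := fun h => hl₁ (by simp [h])
    have hne' : L₂ ≠ [] := fun h => hl₂ (by simp [h])
    -- Both intermediate states are vertices of `x`, so the transition between them is a face of
    -- `x`.
    rw [hK.cubeTrans_eq (List.nodup_append.1 hn').1 hne ih2,
      hK.cubeTrans_eq hn' (by simp [hne]) ih4]
    exact (cubeTr_listVtx hn' hne').cubeTrans x

/-- Both transitions are edges with the same ends, hence the same edge, whose only action is the
common one. -/
theorem Regular.csa1 (hK : Regular K) : (realization K).CSA1 := by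
  intro α β a b ha hb _
  obtain ⟨m, x, -, hx, hx', hp⟩ := hK.cubeTrans_of_rTr ha
  obtain ⟨n, y, -, hy, hy', hq⟩ := hK.cubeTrans_of_rTr hb
  obtain rfl : 1 = m := hp.length_eq.trans List.length_ofFn
  obtain rfl : 1 = n := hq.length_eq.trans List.length_ofFn
  have e : x = y := by
    refine hK.vertex_ext x y fun v => ?_
    have hv : v = fun _ => v 0 := funext fun i => by rw [Subsingleton.elim i 0]
    rw [hv]
    cases v 0 with
    | false => exact rState_inj.1 (hx.symm.trans hy)
    | true => exact rState_inj.1 (hx'.symm.trans hy')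
  subst e
  exact List.singleton_perm_singleton.1 (hp.trans hq.symm)

/-- The transition is a cube `x`; the vertex of `x` reached along the first block of directions is
an intermediate state, and `Regular.cubeTrans_eq` makes it the only one. -/
theorem Regular.uniqueIntermediateState (hK : Regular K) :
    (realization K).UniqueIntermediateState := by
  intro α β l₁ l₂ hl₁ hl₂ h
  obtain ⟨n, x, hn, rfl, rfl, h3⟩ := hK.cubeTrans_of_rTr h
  obtain ⟨L, hL, e⟩ := hK.exists_indices h3
  obtain ⟨L₁, L₂, rfl, rfl, rfl⟩ := List.map_eq_append_iff.1 e.symm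
  have hn := hL.nodup_iff.2 (List.nodup_finRange n)
  have hn' := (List.nodup_append.1 hn).1
  have hne : L₁ ≠ [] := fun h => hl₁ (congrArg _ h)
  have hne' : L₂ ≠ [] := fun h => hl₂ (congrArg _ h)
  refine ⟨rState K x (listVtx L₁), ⟨?_, ?_⟩, fun ν hν =>
    hK.cubeTrans_eq hn' hne (hK.cubeTrans_of_rTr hν.1)⟩
  · have h := RTr.cube x _ _ _ (cubeTr_listVtx (l := []) (l' := L₁) hn' hne)
    rwa [listVtx_nil] at h
  · have h := RTr.cube x _ _ _ (cubeTr_listVtx hn hne')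
    rwa [listVtx_eq_true hL] at h

end Realization

/-! ### From unique intermediate states to CSA2 and CSA3. -/

theorem WHDTS.UniqueIntermediateState.csa2 {A : Type u} {X : WHDTS A}
    (h : X.UniqueIntermediateState) : X.CSA2 := fun α β l₁ l₂ h1 h2 ht =>
  ⟨h α β l₁ l₂ h1 h2 ht, h α β l₂ l₁ h2 h1 (X.multiset List.perm_append_comm ht)⟩

theorem WHDTS.UniqueIntermediateState.csa3 {A : Type u} {X : WHDTS A}
    (h : X.UniqueIntermediateState) : X.CSA3 := by
  intro α β ν₁ ν₂ ν₁' ν₂' l₁ l₂ l₃ h1 h2 h3 ht t1 t2 t3 t4 t5 t6 t7 t8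
  -- Coherence makes `ν₁` an intermediate state on the way from `α` to `ν₂'`, where it competes with
  -- `ν₁'`, and makes `ν₂'` one on the way from `ν₁` to `β`, where it competes with `ν₂`.
  have e := X.coherence h1 h2 h3 ht t1 t2 t5 t6
  obtain rfl := (h α ν₂' l₁ l₂ h1 h2 t5).unique ⟨t1, e⟩ ⟨t7, t8⟩
  exact ⟨rfl, (h ν₁ β l₂ l₃ h2 h3 t2).unique ⟨t3, t4⟩ ⟨e, t6⟩⟩

/-! ### Regularity of standard cubes and of subobjects. -/

variable {A : Type u}

/-- The event of a direction is the direction of the ambient cube to which it is sent. The target of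
a face is its source with these coordinates raised to `1`, which gives determinism. -/
theorem regular_stdCube {n : ℕ} (a : Fin n → A) : Regular (stdCube a) := by
  refine Regular.of_events (E := Fin n) (fun x i => x.down.dir i) (fun f x i => x.down.dir_comp f i)
    (fun x y h => ?_) (fun x h => ?_) (fun x => x.down.dir_injective) (fun x y hs hr => ?_)
  · refine ULift.ext _ _ (BoxHom.ext fun v => ?_)
    exact congrArg (fun z : ULift (BoxHom 0 n) => z.down fun i => i.elim0) (h v)
  · have e : x.down (fun _ => false) = x.down (fun _ => true) :=
      congrArg (fun z : ULift (BoxHom 0 n) => z.down fun i => i.elim0) h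
    exact absurd (congrFun (x.down.inj e) 0) (by decide)
  · have e : x.down (fun _ => false) = y.down (fun _ => false) :=
      congrArg (fun z : ULift (BoxHom 0 n) => z.down fun i => i.elim0) hs
    have key : x.down (fun _ => true) = y.down (fun _ => true) := by
      funext k
      by_cases hk : k ∈ Set.range x.down.dir
      · have hk' := hk
        rw [hr] at hk'
        obtain ⟨i, rfl⟩ := hk
        obtain ⟨j, hj⟩ := hk'
        beta_reduce at hj
        rw [x.down.apply_dir, ← hj, y.down.apply_dir]
      · have hk' := hk
        rw [hr] at hk'
        rw [x.down.apply_not_dir k (fun i hi => hk ⟨i, hi⟩),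
          y.down.apply_not_dir k (fun i hi => hk' ⟨i, hi⟩), e]
    exact ULift.ext _ _ (BoxHom.ext fun _ => key)

/-- The actions of `K` serve as events: removing cubes may separate actions identified in `K`, and
this only helps. -/
theorem Regular.sub {K : LSPS A} (hK : Regular K) (p : ∀ {n : ℕ}, K.cube n → Prop)
    (hp : ∀ {m n : ℕ} (f : BoxHom m n) (x : K.cube n), p x → p (K.map f x)) :
    Regular (K.sub p hp) :=
  Regular.of_events (E := RAction K) (fun x => rAction K x.1) (fun f x => rAction_map f x.1)
    (fun x y h => Subtype.ext (hK.vertex_ext x.1 y.1 fun v => congrArg Subtype.val (h v)))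
    (fun x h => hK.no_loop x.1 (congrArg Subtype.val h))
    (fun x => hK.action_injective x.1)
    (fun x y hs hr => Subtype.ext (hK.det x.1 y.1 (congrArg Subtype.val hs) hr))

/-! ### Gluing two sets along a state. -/

section Glue

variable {K L : LSPS A} {x : K.cube 0} {y : L.cube 0}

/-- The equality of the images in `glue K L x y` of two cubes. -/
def GlueEq (K L : LSPS A) (x : K.cube 0) (y : L.cube 0) {k : ℕ} :
    K.cube k ⊕ L.cube k → K.cube k ⊕ L.cube k → Prop
  | Sum.inl a, Sum.inl a' => a = a'
  | Sum.inl a, Sum.inr b => ∃ f : BoxHom k 0, a = K.map f x ∧ b = L.map f y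
  | Sum.inr b, Sum.inl a => ∃ f : BoxHom k 0, a = K.map f x ∧ b = L.map f y
  | Sum.inr b, Sum.inr b' => b = b'

theorem boxHom_zero_unique {k : ℕ} (f g : BoxHom k 0) : f = g :=
  BoxHom.ext fun _ => Subsingleton.elim _ _

theorem glueEq_equivalence (k : ℕ) : Equivalence (GlueEq K L x y (k := k)) where
  refl := by rintro (a | b) <;> rfl
  symm := by
    rintro (a | b) (a' | b') h
    exacts [Eq.symm h, h, h, Eq.symm h]
  trans := by
    rintro (a | b) (a' | b') (a'' | b'') h h'
    · exact Eq.trans h h'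
    · obtain rfl : a = a' := h
      exact h'
    · obtain ⟨f, rfl, rfl⟩ := h
      obtain ⟨g, rfl, -⟩ := h'
      rw [boxHom_zero_unique f g]
      rfl
    · obtain rfl : b' = b'' := h'
      exact h
    · obtain rfl : a' = a'' := h'
      exact h
    · obtain ⟨f, rfl, rfl⟩ := h
      obtain ⟨g, -, rfl⟩ := h'
      rw [boxHom_zero_unique f g]
      rfl
    · obtain rfl : b = b' := h
      exact h'
    · exact Eq.trans h h'

/-- `GlueEq` is an equivalence relation containing the generators, so it contains the relation they
generate. Hence both summands embed in the gluing and meet only in the glued state. -/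
theorem glue_exact {k : ℕ} {p q : K.cube k ⊕ L.cube k}
    (h : (Quot.mk _ p : (glue K L x y).cube k) = Quot.mk _ q) : GlueEq K L x y p q := by
  refine (glueEq_equivalence k).eqvGen_iff.1 ((Quot.eqvGen_exact h).mono ?_)
  rintro _ _ ⟨f⟩
  exact ⟨f, rfl, rfl⟩

theorem glue_inl_injective (k : ℕ) : Function.Injective
    (fun a => Quot.mk _ (Sum.inl a) : K.cube k → (glue K L x y).cube k) :=
  fun _ _ h => glue_exact h

theorem glue_inr_injective (k : ℕ) : Function.Injective
    (fun b => Quot.mk _ (Sum.inr b) : L.cube k → (glue K L x y).cube k) :=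
  fun _ _ h => glue_exact h

theorem glue_vertex {a : K.cube 0} {b : L.cube 0}
    (h : (Quot.mk _ (Sum.inl a) : (glue K L x y).cube 0) = Quot.mk _ (Sum.inr b)) :
    a = x ∧ b = y := by
  obtain ⟨f, ha, hb⟩ := glue_exact h
  rw [K.map_zero] at ha
  rw [L.map_zero] at hb
  exact ⟨ha, hb⟩

theorem Regular.no_loop_of_pos (hK : Regular K) {n : ℕ} (hn : 0 < n) (a : K.cube n) (v : K.cube 0)
    (h : ∀ w, K.vtx a w = v) : False := by
  refine hK.no_loop (K.map (BoxHom.axis ⟨0, hn⟩) a) ?_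
  rw [LSPS.source, LSPS.target, K.vtx_map, K.vtx_map, h, h]

theorem range_eq_of_comp_range_eq {α β ι κ : Type*} {f : α → β} (hf : Function.Injective f)
    {g : ι → α} {h : κ → α} (e : Set.range (f ∘ g) = Set.range (f ∘ h)) :
    Set.range g = Set.range h := by
  rw [Set.range_comp, Set.range_comp] at e
  exact hf.image_injective e

/-- The events form the disjoint union of the actions of `K` and of `L`. Comparisons inside one
summand reduce to that summand; a comparison across the summands succeeds only for points. -/
theorem Regular.glue (hK : Regular K) (hL : Regular L) : Regular (glue K L x y) := by
  refine Regular.of_events (E := RAction K ⊕ RAction L)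
    (fun {k} z => Quot.lift (Sum.elim (fun a i => Sum.inl (rAction K a i))
      (fun b i => Sum.inr (rAction L b i))) (by
        rintro _ _ ⟨f⟩
        funext i
        exact (f.dir i).elim0) z) ?_ ?_ ?_ ?_ ?_
  · intro m n f
    refine quot_sum_cases (fun a i => ?_) (fun b i => ?_)
    · exact congrArg Sum.inl (rAction_map f a i)
    · exact congrArg Sum.inr (rAction_map f b i)
  -- A cube of `K` and a cube of `L` with the same vertices have all their vertices at the glued
  -- state, which in positive dimension would produce a loop.
  · have key : ∀ {n : ℕ} (a : K.cube n) (b : L.cube n),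
        (∀ v, (CCS.glue K L x y).vtx (Quot.mk _ (Sum.inl a)) v =
          (CCS.glue K L x y).vtx (Quot.mk _ (Sum.inr b)) v) →
        (Quot.mk _ (Sum.inl a) : (CCS.glue K L x y).cube n) = Quot.mk _ (Sum.inr b) := by
      intro n a b h
      rcases Nat.eq_zero_or_pos n with rfl | hn
      · exact ((CCS.glue K L x y).vtx_zero _ _).symm.trans
          ((h fun i => i.elim0).trans ((CCS.glue K L x y).vtx_zero _ _))
      · exact (hK.no_loop_of_pos hn a x fun w => (glue_vertex (h w)).1).elim
    intro n
    refine quot_sum_cases (fun a => quot_sum_cases (fun a' h => ?_) (fun b => key a b))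
      (fun b => quot_sum_cases (fun a h => (key a b fun v => (h v).symm).symm) (fun b' h => ?_))
    · rw [hK.vertex_ext a a' fun v => glue_inl_injective 0 (h v)]
    · rw [hL.vertex_ext b b' fun v => glue_inr_injective 0 (h v)]
  · refine quot_sum_cases (fun a h => ?_) (fun b h => ?_)
    · exact hK.no_loop a (glue_inl_injective 0 h)
    · exact hL.no_loop b (glue_inr_injective 0 h)
  · intro n
    refine quot_sum_cases (fun a => ?_) (fun b => ?_)
    · exact Sum.inl_injective.comp (hK.action_injective a)
    · exact Sum.inr_injective.comp (hL.action_injective b)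
  -- Sets of events in different summands agree only if both are empty; then both cubes are points
  -- and source and target coincide.
  · have key : ∀ {m n : ℕ} (a : K.cube m) (b : L.cube n),
        (CCS.glue K L x y).source (Quot.mk _ (Sum.inl a)) =
          (CCS.glue K L x y).source (Quot.mk _ (Sum.inr b)) →
        Set.range (fun i => (Sum.inl (rAction K a i) : RAction K ⊕ RAction L)) =
          Set.range (fun i => (Sum.inr (rAction L b i) : RAction K ⊕ RAction L)) →
        (CCS.glue K L x y).target (Quot.mk _ (Sum.inl a)) =
          (CCS.glue K L x y).target (Quot.mk _ (Sum.inr b)) := by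
      intro m n a b hs hr
      rcases Nat.eq_zero_or_pos m with rfl | hm
      · rcases Nat.eq_zero_or_pos n with rfl | hn
        · have e : (fun _ : Fin 0 => true) = fun _ => false := Subsingleton.elim _ _
          unfold LSPS.target
          rw [e]
          exact hs
        · have h : Sum.inr (rAction L b ⟨0, hn⟩) ∈
              Set.range (fun i => (Sum.inl (rAction K a i) : RAction K ⊕ RAction L)) :=
            hr ▸ ⟨_, rfl⟩
          exact h.choose.elim0
      · have h : Sum.inl (rAction K a ⟨0, hm⟩) ∈
            Set.range (fun i => (Sum.inr (rAction L b i) : RAction K ⊕ RAction L)) :=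
          hr ▸ ⟨_, rfl⟩
        obtain ⟨i, hi⟩ := h
        cases hi
    intro m n
    refine quot_sum_cases (fun a => quot_sum_cases (fun a' hs hr => ?_) (fun b => key a b))
      (fun b => quot_sum_cases (fun a hs hr => (key a b hs.symm hr.symm).symm) (fun b' hs hr => ?_))
    · refine congrArg (fun a => Quot.mk _ (Sum.inl a)) (hK.det a a' (glue_inl_injective 0 hs)
        (range_eq_of_comp_range_eq Sum.inl_injective hr))
    · refine congrArg (fun a => Quot.mk _ (Sum.inr a)) (hL.det b b' (glue_inr_injective 0 hs)
        (range_eq_of_comp_range_eq Sum.inr_injective hr))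

/-- If states of different summands are identified after the map, both go to the gluing points, so
by injectivity they were the gluing points already. -/
theorem glueMap_injective {K' L' : LSPS A} {x' : K'.cube 0} {y' : L'.cube 0}
    (φ : LSPS.Hom K K') (ψ : LSPS.Hom L L') (hx : φ.app x = x') (hy : ψ.app y = y')
    (hφ : Function.Injective (φ.app (n := 0))) (hψ : Function.Injective (ψ.app (n := 0))) :
    Function.Injective ((glueMap φ ψ hx hy).app (n := 0)) := by
  have key : ∀ (a : K.cube 0) (b : L.cube 0),
      (glueMap φ ψ hx hy).app (Quot.mk _ (Sum.inl a)) =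
        (glueMap φ ψ hx hy).app (Quot.mk _ (Sum.inr b)) →
      (Quot.mk _ (Sum.inl a) : (glue K L x y).cube 0) = Quot.mk _ (Sum.inr b) := by
    intro a b h
    obtain ⟨ha, hb⟩ := glue_vertex h
    obtain rfl := hφ (ha.trans hx.symm)
    obtain rfl := hψ (hb.trans hy.symm)
    have e := GlueRel.mk (K := K) (L := L) (x := a) (y := b) (BoxHom.id 0)
    rw [K.map_id, L.map_id] at e
    exact Quot.sound e
  intro z z'
  revert z z'
  refine quot_sum_cases (fun a => quot_sum_cases (fun a' h => ?_) (fun b => key a b))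
    (fun b => quot_sum_cases (fun a h => (key a b h.symm).symm) (fun b' h => ?_))
  · exact congrArg (fun a => Quot.mk _ (Sum.inl a)) (hφ (glue_inl_injective 0 h))
  · exact congrArg (fun a => Quot.mk _ (Sum.inr a)) (hψ (glue_inr_injective 0 h))

end Glue

/-! ### Sequential colimits -/

theorem leRecOn_naturality {X Y : ℕ → Type*} {s : ∀ {k}, X k → X (k + 1)}
    {t : ∀ {k}, Y k → Y (k + 1)} (g : ∀ k, X k → Y k)
    (hg : ∀ k (x : X k), g (k + 1) (s x) = t (g k x)) {k m : ℕ} (h : k ≤ m) (x : X k) :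
    g m (Nat.leRecOn h s x) = Nat.leRecOn h t (g k x) := by
  induction m, h using Nat.le_induction with
  | base => rw [Nat.leRecOn_self, Nat.leRecOn_self]
  | succ m h ih => rw [Nat.leRecOn_succ h, Nat.leRecOn_succ h, hg, ih]

/-- Two elements of a sequence of sets become equal in the colimit. -/
def seqSetoid (X : ℕ → Type u) (s : ∀ {k}, X k → X (k + 1)) : Setoid (Σ k, X k) where
  r p q := ∃ (m : ℕ) (h : p.1 ≤ m) (h' : q.1 ≤ m), (Nat.leRecOn h s p.2 : X m) = Nat.leRecOn h' s q.2
  iseqv :=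
    { refl := fun p => ⟨p.1, le_rfl, le_rfl, rfl⟩
      symm := fun ⟨m, h, h', e⟩ => ⟨m, h', h, e.symm⟩
      trans := by
        rintro p q r ⟨m, h1, h2, e⟩ ⟨m', h3, h4, e'⟩
        refine ⟨max m m', h1.trans (le_max_left _ _), h4.trans (le_max_right _ _), ?_⟩
        rw [Nat.leRecOn_trans h1 (le_max_left _ _), e, ← Nat.leRecOn_trans h2 (le_max_left _ _),
          Nat.leRecOn_trans h3 (le_max_right m m'), e', ← Nat.leRecOn_trans h4] }

theorem seqSetoid_succ {X : ℕ → Type u} (s : ∀ {k}, X k → X (k + 1)) (k : ℕ) (x : X k) :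
    (Quotient.mk (seqSetoid X s) ⟨k, x⟩) = Quotient.mk (seqSetoid X s) ⟨k + 1, s x⟩ :=
  Quotient.sound ⟨k + 1, k.le_succ, le_rfl, by rw [Nat.leRecOn_succ', Nat.leRecOn_self]⟩

/-- The form "eventually" allows finitely many identifications to be realized at one common stage.
-/
theorem seqSetoid_eventually {X : ℕ → Type u} {s : ∀ {k}, X k → X (k + 1)} {k : ℕ} {x y : X k}
    (h : Quotient.mk (seqSetoid X s) ⟨k, x⟩ = Quotient.mk (seqSetoid X s) ⟨k, y⟩) :
    ∀ᶠ m in Filter.atTop, ∀ hm : k ≤ m, (Nat.leRecOn hm s x : X m) = Nat.leRecOn hm s y := by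
  obtain ⟨m, h1, h2, e⟩ := Quotient.exact h
  filter_upwards [Filter.eventually_ge_atTop m] with m' hm' hm
  rw [Nat.leRecOn_trans h1 hm', e, ← Nat.leRecOn_trans h2 hm']

section SeqColim

variable {X : ℕ → PLSPS A} (s : ∀ k, X k ⟶ X (k + 1))

/-- The canonical map from a term of a sequence to a later term. -/
def seqPush {n k m : ℕ} (h : k ≤ m) (x : (X k).cube n) : (X m).cube n :=
  Nat.leRecOn (C := fun k => (X k).cube n) h (fun {k} => (s k).app) x

theorem seqIn_succ {n : ℕ} (k : ℕ) (x : (X k).cube n) :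
    seqIn s (k + 1) ((s k).app x) = seqIn s k x :=
  (Quot.sound (SeqRel.mk k x)).symm

theorem seqIn_seqPush {n k m : ℕ} (h : k ≤ m) (x : (X k).cube n) :
    seqIn s m (seqPush s h x) = seqIn s k x := by
  induction m, h using Nat.le_induction with
  | base => rw [seqPush, Nat.leRecOn_self]
  | succ m h ih => rw [seqPush, Nat.leRecOn_succ h, seqIn_succ]; exact ih

theorem seqPush_map {l n k m : ℕ} (h : k ≤ m) (f : BoxHom l n) (x : (X k).cube n) :
    (X m).map f (seqPush s h x) = seqPush s h ((X k).map f x) :=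
  leRecOn_naturality (fun k => (X k).map f) (fun k x => ((s k).app_map f x).symm) h x

theorem rAction_seqPush {n k m : ℕ} (h : k ≤ m) (x : (X k).cube n) (i : Fin n) :
    rAction (X m).toLSPS (seqPush s h x) i =
      Nat.leRecOn (C := fun k => RAction (X k).toLSPS) h (fun {k} => RAction.map (s k).toHom)
        (rAction (X k).toLSPS x i) :=
  leRecOn_naturality (X := fun k => (X k).cube n) (Y := fun k => RAction (X k).toLSPS)
    (fun k x => rAction (X k).toLSPS x i) (fun _ _ => rfl) h x

/-- The colimit maps to the quotient by `seqSetoid`, where equality means equality at a later stage.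
-/
theorem seqIn_exact {n k k' : ℕ} {x : (X k).cube n} {x' : (X k').cube n}
    (h : seqIn s k x = seqIn s k' x') :
    ∃ (m : ℕ) (h : k ≤ m) (h' : k' ≤ m), seqPush s h x = seqPush s h' x' := by
  let g : (seqColim X s).cube n → Quotient (seqSetoid (fun k => (X k).cube n) fun {k} => (s k).app) :=
    Quot.lift (fun z => Quotient.mk _ ⟨z.1.down, z.2⟩) (by
      rintro _ _ ⟨k, x⟩
      exact seqSetoid_succ (X := fun k => (X k).cube n) (fun {k} => (s k).app) k x)
  exact Quotient.exact (congrArg g h)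

theorem seqIn_surjective {n : ℕ} (z : (seqColim X s).cube n) : ∃ k x, z = seqIn s k x := by
  obtain ⟨⟨⟨k⟩, x⟩⟩ := z
  exact ⟨k, x, rfl⟩

theorem exists_seqIn_pair {m n : ℕ} (z : (seqColim X s).cube m) (z' : (seqColim X s).cube n) :
    ∃ k x x', z = seqIn s k x ∧ z' = seqIn s k x' := by
  obtain ⟨k, x, rfl⟩ := seqIn_surjective s z
  obtain ⟨k', x', rfl⟩ := seqIn_surjective s z'
  exact ⟨max k k', seqPush s (le_max_left _ _) x, seqPush s (le_max_right _ _) x',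
    (seqIn_seqPush s _ _).symm, (seqIn_seqPush s _ _).symm⟩

variable {s} in
theorem seqIn_injective (hX : ∀ k, Regular (X k).toLSPS)
    (hs : ∀ k, Function.Injective ((s k).app (n := 0))) (n k : ℕ) :
    Function.Injective (seqIn s k : (X k).cube n → _) := by
  intro x x' h
  obtain ⟨m, h1, h2, e⟩ := seqIn_exact s h
  exact Nat.leRecOn_injective h1 _ (fun k => (hX k).app_injective (s k).toHom (hs k) n) e

/-- Cubes of the terms embed in the colimit, so statements about vertices descend to any stage
containing the cubes. The maps between the sets of actions need not be injective: the events are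
taken in the colimit of these sets, and equalities of events are realized at a later stage, a common
one existing because a cube has finitely many directions. -/
theorem Regular.seqColim (hX : ∀ k, Regular (X k).toLSPS)
    (hs : ∀ k, Function.Injective ((s k).app (n := 0))) : Regular (seqColim X s).toLSPS := by
  refine Regular.of_events
    (E := Quotient (seqSetoid (fun k => RAction (X k).toLSPS) fun {k} => RAction.map (s k).toHom))
    (fun {n} z i => Quot.lift (fun z => Quotient.mk _ ⟨z.1.down, rAction (X z.1.down).toLSPS z.2 i⟩)
      (by
        rintro _ _ ⟨k, x⟩
        exact seqSetoid_succ (X := fun k => RAction (X k).toLSPS)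
          (fun {k} => RAction.map (s k).toHom) k _) z) ?_ ?_ ?_ ?_ ?_
  · rintro m n f ⟨⟨⟨k⟩, x⟩⟩ i
    exact congrArg (fun u => Quotient.mk (seqSetoid (fun k => RAction (X k).toLSPS)
      fun {k} => RAction.map (s k).toHom) ⟨k, u⟩) (rAction_map f x i)
  · intro n z z' h
    obtain ⟨k, x, x', rfl, rfl⟩ := exists_seqIn_pair s z z'
    rw [(hX k).vertex_ext x x' fun v => seqIn_injective hX hs 0 k (h v)]
  · intro z h
    obtain ⟨k, x, rfl⟩ := seqIn_surjective s z
    exact (hX k).no_loop x (seqIn_injective hX hs 0 k h)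
  · intro n z i j h
    obtain ⟨k, x, rfl⟩ := seqIn_surjective s z
    obtain ⟨m, hm, hkm⟩ := ((seqSetoid_eventually h).and (Filter.eventually_ge_atTop k)).exists
    have e := hm hkm
    rw [← rAction_seqPush, ← rAction_seqPush] at e
    exact (hX m).action_injective _ e
  · intro m n z z' hz hr
    obtain ⟨k, x, x', rfl, rfl⟩ := exists_seqIn_pair s z z'
    -- Each direction of one cube is matched with a direction of the other having the same event; at
    -- the stage `M` below all these matches are equalities of actions.
    have h1 : ∀ i, ∃ j, _ := fun i => hr.le ⟨i, rfl⟩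
    have h2 : ∀ j, ∃ i, _ := fun j => hr.ge ⟨j, rfl⟩
    choose c hc using h1
    choose d hd using h2
    have e1 := Filter.eventually_all.2 fun i => seqSetoid_eventually (hc i)
    have e2 := Filter.eventually_all.2 fun i => seqSetoid_eventually (hd i)
    obtain ⟨M, ⟨hM1, hM2⟩, hkM⟩ := ((e1.and e2).and (Filter.eventually_ge_atTop k)).exists
    have hs' : (X M).source (seqPush s hkM x) = (X M).source (seqPush s hkM x') := by
      rw [LSPS.source, LSPS.source, LSPS.vtx, LSPS.vtx, seqPush_map, seqPush_map]
      exact congrArg _ (seqIn_injective hX hs 0 k hz)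
    have h := (hX M).det (seqPush s hkM x) (seqPush s hkM x') hs' (by
      refine Set.Subset.antisymm ?_ ?_
      · rintro _ ⟨i, rfl⟩
        refine ⟨c i, ?_⟩
        rw [rAction_seqPush, rAction_seqPush]
        exact hM1 i hkM
      · rintro _ ⟨j, rfl⟩
        refine ⟨d j, ?_⟩
        rw [rAction_seqPush, rAction_seqPush]
        exact hM2 j hkM)
    rw [← seqIn_seqPush s hkM x, ← seqIn_seqPush s hkM x']
    exact congrArg (seqIn s M) h

theorem seqColimMap_injective {Y : ℕ → PLSPS A} {t : ∀ k, Y k ⟶ Y (k + 1)}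
    (hY : ∀ k, Regular (Y k).toLSPS) (ht : ∀ k, Function.Injective ((t k).app (n := 0)))
    (φ : ∀ k, X k ⟶ Y k) (hφ : ∀ k, s k ≫ φ (k + 1) = φ k ≫ t k)
    (h : ∀ k, Function.Injective ((φ k).app (n := 0))) :
    Function.Injective ((seqColimMap φ hφ).app (n := 0)) := by
  intro z z' hz
  obtain ⟨k, x, x', rfl, rfl⟩ := exists_seqIn_pair s z z'
  exact congrArg (seqIn s k) (h k (seqIn_injective hY ht 0 k hz))

end SeqColim

/-! ### Edges of cubes and factorization through projections. -/

namespace BoxHom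

theorem axis_false {n : ℕ} (i : Fin n) : axis i (fun _ => false) = fun _ => false := by
  funext j
  by_cases h : j = i <;> simp [axis, ofCoord, h]

theorem axis_true {n : ℕ} (i : Fin n) :
    axis i (fun _ => true) = Function.update (fun _ => false) i true := by
  funext j
  by_cases h : j = i <;> simp [axis, ofCoord, h]

theorem axis_dir {n : ℕ} (i : Fin n) (j : Fin 1) : (axis i).dir j = i :=
  ofCoord_dir _ _ j i (by simp [Subsingleton.elim j 0])

theorem vtx_one_eq (v : Vtx 1) : v = fun _ => v 0 :=
  funext fun i => by rw [Subsingleton.elim i 0]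

theorem edge_ext {n : ℕ} {e e' : BoxHom 1 n} (h0 : e (fun _ => false) = e' fun _ => false)
    (h1 : e (fun _ => true) = e' fun _ => true) : e = e' := by
  refine ext fun v => ?_
  rw [vtx_one_eq v]
  cases v 0
  exacts [h0, h1]

theorem edge_lt {n : ℕ} (e : BoxHom 1 n) : e (fun _ => false) < e fun _ => true :=
  e.strictMono (Pi.lt_def.2 ⟨fun _ => Bool.false_le _, 0, by decide⟩)

theorem edge_dist {n : ℕ} (e : BoxHom 1 n) :
    hammingDist (e fun _ => false) (e fun _ => true) = 1 :=
  e.adj _ _ (by decide)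

/-- The edge between two vertices at distance one. -/
def ofEdge {n : ℕ} (v w : Vtx n) (hlt : v < w) (hd : hammingDist v w = 1) : BoxHom 1 n where
  toFun x := if x 0 then w else v
  strictMono x y hxy := by
    rw [vtx_one_eq x, vtx_one_eq y] at hxy ⊢
    cases hx : x 0 <;> cases hy : y 0 <;> rw [hx, hy] at hxy
    · exact absurd hxy (lt_irrefl _)
    · simpa using hlt
    · exact absurd hxy.le (fun h => absurd (h 0) (by decide))
    · exact absurd hxy (lt_irrefl _)
  adj x y hxy := by
    rw [vtx_one_eq x, vtx_one_eq y] at hxy ⊢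
    cases hx : x 0 <;> cases hy : y 0 <;> rw [hx, hy] at hxy
    · simp at hxy
    · simpa using hd
    · simpa [hammingDist_comm] using hd
    · simp at hxy
  inj x y hxy := by
    rw [vtx_one_eq x, vtx_one_eq y]
    have := hlt.ne
    cases hx : x 0 <;> cases hy : y 0 <;> simp_all

/-- A morphism of `□_S` reflects the order and preserves distances, so `v` and `w` are already the
ends of an edge. -/
theorem exists_edge_lift {m n : ℕ} (f : BoxHom m n) (e : BoxHom 1 n) {v w : Vtx m}
    (hv : e (fun _ => false) = f v) (hw : e (fun _ => true) = f w) :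
    ∃ e' : BoxHom 1 m, f.comp e' = e ∧ e' (fun _ => false) = v ∧ e' (fun _ => true) = w := by
  have hlt : v < w := by
    have h := e.edge_lt
    rw [hv, hw] at h
    refine lt_of_le_of_ne (fun i => ?_) (fun hvw => h.ne (congrArg f hvw))
    have := h.le (f.dir i)
    rwa [f.apply_dir, f.apply_dir] at this
  have hd : hammingDist v w = 1 := by
    rw [← f.hammingDist_apply, ← hv, ← hw, e.edge_dist]
  refine ⟨ofEdge v w hlt hd, edge_ext ?_ ?_, ?_, ?_⟩ <;> simp [ofEdge, hv, hw]

end BoxHom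

/-- A map all of whose coordinates are constants or coordinates of the argument, each coordinate
of the argument being used at most once, is a projection followed by a morphism of `□_S`. -/
theorem exists_projection {k m : ℕ} (h : Fin m → Fin k ⊕ Bool)
    (hu : ∀ i j j', h j = Sum.inl i → h j' = Sum.inl i → j = j') :
    ∃ (p : ℕ) (f : BoxHom p m) (s : Fin p → Fin k), StrictMono s ∧
      (∀ i, i ∈ Set.range s ↔ ∃ j, h j = Sum.inl i) ∧
      ∀ ε : Vtx k, f (ε ∘ s) = fun j => Sum.elim ε (fun b => b) (h j) := by
  classical
  let P : Finset (Fin k) := Finset.univ.filter fun i => ∃ j, h j = Sum.inl i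
  let s : Fin P.card → Fin k := P.orderEmbOfFin rfl
  have hs : Function.Injective s := (P.orderEmbOfFin rfl).injective
  have hr : ∀ i, i ∈ Set.range s ↔ ∃ j, h j = Sum.inl i := fun i => by
    rw [Finset.range_orderEmbOfFin]
    simp [P]
  -- The value `false` in the last branch is never attained: a coordinate `h j = Sum.inl i` has `i`
  -- in the range of `s`.
  let c : Fin m → Fin P.card ⊕ Bool := fun j => if hj : ∃ a, h j = Sum.inl (s a)
    then Sum.inl hj.choose else Sum.inr (Sum.elim (fun _ => false) (fun b => b) (h j))
  have hc : ∀ j a, c j = Sum.inl a ↔ h j = Sum.inl (s a) := by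
    intro j a
    by_cases hj : ∃ a, h j = Sum.inl (s a)
    · have e : c j = Sum.inl hj.choose := dif_pos hj
      rw [e]
      constructor
      · rintro ⟨⟩
        exact hj.choose_spec
      · intro ha
        rw [hs (Sum.inl.inj (hj.choose_spec.symm.trans ha))]
    · have e : c j = Sum.inr _ := dif_neg hj
      rw [e]
      exact ⟨fun h => (by cases h), fun ha => (hj ⟨a, ha⟩).elim⟩
  refine ⟨P.card, BoxHom.ofCoord c fun a => ?_, s, (P.orderEmbOfFin rfl).strictMono, hr,
    fun ε => funext fun j => ?_⟩
  · obtain ⟨j, hj⟩ := (hr (s a)).1 ⟨a, rfl⟩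
    exact ⟨j, (hc j a).2 hj, fun j' hj' => hu _ _ _ ((hc j' a).1 hj') hj⟩
  · rw [BoxHom.ofCoord_apply]
    cases hj : h j with
    | inl i =>
      obtain ⟨a, rfl⟩ := (hr i).2 ⟨j, hj⟩
      rw [(hc j a).2 hj]
      rfl
    | inr b =>
      have e : c j = Sum.inr (Sum.elim (fun _ => false) (fun b => b) (h j)) :=
        dif_neg (by rintro ⟨a, ha⟩; rw [hj] at ha; cases ha)
      rw [e, hj]
      rfl

/-! ### Cubes of the directed coskeleton of a fibered product. -/

section SyncCube

variable (S : SyncLabels A) {m n : ℕ} {a : Fin m → A} {b : Fin n → A}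

/-- What an edge of the fibered product of two cubes does to the coordinates. -/
theorem fiberedProduct_edge (e : (fiberedProduct S (cubeGraph a) (cubeGraph b)).E) :
    ((fiberedProduct S (cubeGraph a) (cubeGraph b)).src e).1 ≤
        ((fiberedProduct S (cubeGraph a) (cubeGraph b)).tgt e).1 ∧
      ((fiberedProduct S (cubeGraph a) (cubeGraph b)).src e).2 ≤
        ((fiberedProduct S (cubeGraph a) (cubeGraph b)).tgt e).2 ∧
      hammingDist ((fiberedProduct S (cubeGraph a) (cubeGraph b)).src e).1
        ((fiberedProduct S (cubeGraph a) (cubeGraph b)).tgt e).1 ≤ 1 ∧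
      hammingDist ((fiberedProduct S (cubeGraph a) (cubeGraph b)).src e).2
        ((fiberedProduct S (cubeGraph a) (cubeGraph b)).tgt e).2 ≤ 1 ∧
      (fiberedProduct S (cubeGraph a) (cubeGraph b)).src e ≠
        (fiberedProduct S (cubeGraph a) (cubeGraph b)).tgt e := by
  rcases e with ⟨e, v⟩ | ⟨v, e⟩ | ⟨⟨e, e'⟩, -⟩
  · exact ⟨e.edge_lt.le, le_rfl, e.edge_dist.le, (hammingDist_self v).trans_le zero_le_one,
      fun h => e.edge_lt.ne (congrArg Prod.fst h)⟩
  · exact ⟨le_rfl, e.edge_lt.le, (hammingDist_self v).trans_le zero_le_one, e.edge_dist.le,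
      fun h => e.edge_lt.ne (congrArg Prod.snd h)⟩
  · exact ⟨e.edge_lt.le, e'.edge_lt.le, e.edge_dist.le, e'.edge_dist.le,
      fun h => e.edge_lt.ne (congrArg Prod.fst h)⟩

/-- The kind of an edge is read off from which of the two components moves, and each moving
component is an edge of a cube, fixed by its ends. -/
theorem fiberedProduct_edge_ext {e e' : (fiberedProduct S (cubeGraph a) (cubeGraph b)).E}
    (h0 : (fiberedProduct S (cubeGraph a) (cubeGraph b)).src e =
      (fiberedProduct S (cubeGraph a) (cubeGraph b)).src e')
    (h1 : (fiberedProduct S (cubeGraph a) (cubeGraph b)).tgt e =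
      (fiberedProduct S (cubeGraph a) (cubeGraph b)).tgt e') : e = e' := by
  rcases e with ⟨e, v⟩ | ⟨v, e⟩ | ⟨⟨e, f⟩, h⟩ <;>
    rcases e' with ⟨e', v'⟩ | ⟨v', e'⟩ | ⟨⟨e', f'⟩, h'⟩ <;>
    simp only [Sum.elim_inl, Sum.elim_inr, Prod.mk.injEq] at h0 h1
  · rw [BoxHom.edge_ext h0.1 h1.1, h0.2]
  · exact (e.edge_lt.ne (h0.1.trans h1.1.symm)).elim
  · exact (f'.edge_lt.ne (h0.2.symm.trans h1.2)).elim
  · exact (e.edge_lt.ne (h0.2.trans h1.2.symm)).elim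
  · rw [BoxHom.edge_ext h0.2 h1.2, h0.1]
  · exact (e'.edge_lt.ne (h0.1.symm.trans h1.1)).elim
  · exact (f.edge_lt.ne (h0.2.trans h1.2.symm)).elim
  · exact (e.edge_lt.ne (h0.1.trans h1.1.symm)).elim
  · obtain rfl := BoxHom.edge_ext h0.1 h1.1
    obtain rfl := BoxHom.edge_ext h0.2 h1.2
    rfl

/-- Moving components lift by `exists_edge_lift`, constant ones by injectivity. Lifting keeps the
labels, so synchronizations lift to synchronizations. -/
theorem exists_fiberedProduct_edge_lift {p q : ℕ} (f : BoxHom p m) (g : BoxHom q n)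
    {a' : Fin p → A} {b' : Fin q → A} (ha : a' = a ∘ f.dir) (hb : b' = b ∘ g.dir)
    (e : (fiberedProduct S (cubeGraph a) (cubeGraph b)).E) {v w : Vtx p × Vtx q}
    (hv : (fiberedProduct S (cubeGraph a) (cubeGraph b)).src e = (f v.1, g v.2))
    (hw : (fiberedProduct S (cubeGraph a) (cubeGraph b)).tgt e = (f w.1, g w.2)) :
    ∃ e' : (fiberedProduct S (cubeGraph a') (cubeGraph b')).E,
      (fiberedProductMap S (cubeGraphMap f ha) (cubeGraphMap g hb)).onE e' = e ∧
      (fiberedProduct S (cubeGraph a') (cubeGraph b')).src e' = v ∧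
      (fiberedProduct S (cubeGraph a') (cubeGraph b')).tgt e' = w := by
  obtain ⟨v1, v2⟩ := v
  obtain ⟨w1, w2⟩ := w
  rcases e with ⟨e, x⟩ | ⟨x, e⟩ | ⟨⟨e, e'⟩, h⟩ <;>
    simp only [Sum.elim_inl, Sum.elim_inr, Prod.mk.injEq] at hv hw
  · obtain ⟨e', rfl, rfl, rfl⟩ := f.exists_edge_lift e hv.1 hw.1
    obtain rfl := g.inj (hv.2.symm.trans hw.2)
    obtain rfl := hv.2
    exact ⟨Sum.inl (e', v2), rfl, rfl, rfl⟩
  · obtain ⟨e', rfl, rfl, rfl⟩ := g.exists_edge_lift e hv.2 hw.2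
    obtain rfl := f.inj (hv.1.symm.trans hw.1)
    obtain rfl := hv.1
    exact ⟨Sum.inr (Sum.inl (v1, e')), rfl, rfl, rfl⟩
  · obtain ⟨e1, rfl, rfl, rfl⟩ := f.exists_edge_lift e hv.1 hw.1
    obtain ⟨e2, rfl, rfl, rfl⟩ := g.exists_edge_lift e' hv.2 hw.2
    refine ⟨Sum.inr (Sum.inr ⟨(e1, e2), ?_⟩), rfl, rfl, rfl⟩
    have h1 := (cubeGraphMap f ha).lab_onE e1
    have h2 := (cubeGraphMap g hb).lab_onE e2
    rw [← h1, ← h2]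
    exact h

variable {S} {k : ℕ}

/-- The vertices of a cube of `syncCube S a b`. -/
def syncV (c : (syncCube S a b).cube k) (ε : Vtx k) : Vtx m × Vtx n := c.1.2.onV ε

/-- Vertices determine edges, and the word labelling the cube is read on the edges along the axes.
-/
theorem syncCube_ext {c c' : (syncCube S a b).cube k} (h : ∀ ε, syncV c ε = syncV c' ε) :
    c = c' := by
  have hE : ∀ e, c.1.2.onE e = c'.1.2.onE e := fun e => by
    refine fiberedProduct_edge_ext S ?_ ?_
    · rw [c.1.2.src_onE, c'.1.2.src_onE]
      exact h _
    · rw [c.1.2.tgt_onE, c'.1.2.tgt_onE]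
      exact h _
  refine Subtype.ext (sigma_hom_ext (funext fun i => ?_) h hE)
  have h1 := c.1.2.lab_onE (BoxHom.axis i)
  have h2 := c'.1.2.lab_onE (BoxHom.axis i)
  rw [hE] at h1
  have h3 := h1.symm.trans h2
  change c.1.1 ((BoxHom.axis i).dir 0) = c'.1.1 ((BoxHom.axis i).dir 0) at h3
  rwa [BoxHom.axis_dir] at h3

theorem syncV_edge (c : (syncCube S a b).cube k) (e : BoxHom 1 k) :
    (syncV c (e fun _ => false)).1 ≤ (syncV c (e fun _ => true)).1 ∧
      (syncV c (e fun _ => false)).2 ≤ (syncV c (e fun _ => true)).2 ∧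
      hammingDist (syncV c (e fun _ => false)).1 (syncV c (e fun _ => true)).1 ≤ 1 ∧
      hammingDist (syncV c (e fun _ => false)).2 (syncV c (e fun _ => true)).2 ≤ 1 ∧
      syncV c (e fun _ => false) ≠ syncV c (e fun _ => true) := by
  have h := fiberedProduct_edge S (c.1.2.onE e)
  rw [c.1.2.src_onE, c.1.2.tgt_onE] at h
  exact h

theorem exists_coord_of_edge {r : ℕ} {x : Vtx 1 → Vtx r}
    (h : x (fun _ => false) ≤ x (fun _ => true)) : ∃ h : Fin r → Fin 1 ⊕ Bool,
      (∀ ε j, x ε j = Sum.elim ε (fun b => b) (h j)) ∧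
      ∀ j, x (fun _ => false) j ≠ x (fun _ => true) j → h j = Sum.inl 0 := by
  refine ⟨fun j => if x (fun _ => false) j = x (fun _ => true) j
    then Sum.inr (x (fun _ => false) j) else Sum.inl 0, fun ε j => ?_, fun j hj => if_neg hj⟩
  have hj := h j
  rw [BoxHom.vtx_one_eq ε]
  revert hj
  cases h1 : x (fun _ => false) j <;> cases h2 : x (fun _ => true) j <;> cases h3 : ε 0 <;>
    simp [h1, h2]

/-- Every coordinate of a vertex of a cube of `syncCube S a b` is a constant or a coordinate of
the argument. -/
theorem syncV_exists_coord (c : (syncCube S a b).cube k) :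
    ∃ (h : Fin m → Fin k ⊕ Bool) (g : Fin n → Fin k ⊕ Bool),
      (∀ ε j, (syncV c ε).1 j = Sum.elim ε (fun b => b) (h j)) ∧
      (∀ ε j, (syncV c ε).2 j = Sum.elim ε (fun b => b) (g j)) ∧
      ∀ i, (∃ j, h j = Sum.inl i) ∨ ∃ j, g j = Sum.inl i := by
  -- Non-twistedness is imposed only from dimension `2` on. In dimension `1` the form of the
  -- coordinates comes from monotonicity, and the use of the variable from the absence of loops.
  match k, c with
  | 0, c =>
    refine ⟨fun j => Sum.inr ((syncV c fun i => i.elim0).1 j),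
      fun j => Sum.inr ((syncV c fun i => i.elim0).2 j), fun ε j => ?_, fun ε j => ?_,
      fun i => i.elim0⟩ <;>
    · rw [Subsingleton.elim ε fun i => i.elim0]
      rfl
  | 1, c =>
    obtain ⟨h1, h2, -, -, h3⟩ := syncV_edge c (BoxHom.id 1)
    obtain ⟨h, hh, hh'⟩ := exists_coord_of_edge (x := fun ε => (syncV c ε).1) h1
    obtain ⟨g, hg, hg'⟩ := exists_coord_of_edge (x := fun ε => (syncV c ε).2) h2
    refine ⟨h, g, hh, hg, fun i => ?_⟩
    rw [Subsingleton.elim i 0]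
    by_contra! hc
    refine h3 (Prod.ext (funext fun j => ?_) (funext fun j => ?_))
    · by_contra hj
      exact hc.1 j (hh' j hj)
    · by_contra hj
      exact hc.2 j (hg' j hj)
  | k + 2, c =>
    obtain ⟨h, h1, h2⟩ := (nonTwisted_iff _).1 (c.2 (Nat.le_add_left 2 k))
    refine ⟨fun j => h (Fin.castAdd n j), fun j => h (Fin.natAdd m j), fun ε j => ?_,
      fun ε j => ?_, fun i => ?_⟩
    · rw [← h1]
      exact (Fin.append_left _ _ _).symm
    · rw [← h1]
      exact (Fin.append_right _ _ _).symm
    · obtain ⟨j, hj⟩ := h2 i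
      revert hj
      refine Fin.addCases (fun j hj => Or.inl ⟨j, hj⟩) (fun j hj => Or.inr ⟨j, hj⟩) j

theorem elim_update_ne_iff {ε : Vtx k} {i : Fin k} (hi : ε i = false) (z : Fin k ⊕ Bool) :
    Sum.elim ε (fun b => b) z ≠ Sum.elim (Function.update ε i true) (fun b => b) z ↔
      z = Sum.inl i := by
  rcases z with l | b
  · by_cases hl : l = i
    · subst hl
      simp [hi]
    · simp [hl]
  · simp

/-- Each direction of a cube of `syncCube S a b` moves at most one coordinate on each side. -/
theorem syncV_coord_unique (c : (syncCube S a b).cube k) :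
    (∀ h : Fin m → Fin k ⊕ Bool, (∀ ε j, (syncV c ε).1 j = Sum.elim ε (fun b => b) (h j)) →
      ∀ i j j', h j = Sum.inl i → h j' = Sum.inl i → j = j') ∧
    (∀ h : Fin n → Fin k ⊕ Bool, (∀ ε j, (syncV c ε).2 j = Sum.elim ε (fun b => b) (h j)) →
      ∀ i j j', h j = Sum.inl i → h j' = Sum.inl i → j = j') := by
  constructor <;> intro h hh i j j' hj hj'
  -- The edge along the axis `i` moves both `j` and `j'`, but it moves at most one coordinate of the
  -- component.
  · have hd := (syncV_edge c (BoxHom.axis i)).2.2.1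
    rw [BoxHom.axis_false, BoxHom.axis_true, hammingDist, Finset.card_le_one] at hd
    refine hd j ?_ j' ?_ <;> rw [Finset.mem_filter, hh, hh, elim_update_ne_iff rfl]
    exacts [⟨Finset.mem_univ _, hj⟩, ⟨Finset.mem_univ _, hj'⟩]
  · have hd := (syncV_edge c (BoxHom.axis i)).2.2.2.1
    rw [BoxHom.axis_false, BoxHom.axis_true, hammingDist, Finset.card_le_one] at hd
    refine hd j ?_ j' ?_ <;> rw [Finset.mem_filter, hh, hh, elim_update_ne_iff rfl]
    exacts [⟨Finset.mem_univ _, hj⟩, ⟨Finset.mem_univ _, hj'⟩]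

/-- Every cube of `syncCube S a b` comes from a cube of `syncCube S a' b'` whose vertices are the
pairs of projections of the vertices of the cube. -/
theorem exists_syncCube_lift (c : (syncCube S a b).cube k) :
    ∃ (p q : ℕ) (f : BoxHom p m) (g : BoxHom q n) (s : Fin p → Fin k) (t : Fin q → Fin k),
      StrictMono s ∧ StrictMono t ∧ (∀ i, i ∈ Set.range s ∨ i ∈ Set.range t) ∧
      ∀ (a' : Fin p → A) (b' : Fin q → A) (ha : a' = a ∘ f.dir) (hb : b' = b ∘ g.dir),
        ∃ c' : (syncCube S a' b').cube k, (∀ ε, syncV c' ε = (ε ∘ s, ε ∘ t)) ∧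
          (syncCubeMap S f g ha hb).app c' = c := by
  obtain ⟨h, h', hh, hh', hc⟩ := syncV_exists_coord c
  obtain ⟨p, f, s, hs, hrs, hf⟩ := exists_projection h ((syncV_coord_unique c).1 h hh)
  obtain ⟨q, g, t, ht, hrt, hg⟩ := exists_projection h' ((syncV_coord_unique c).2 h' hh')
  have hst : ∀ i, i ∈ Set.range s ∨ i ∈ Set.range t := fun i => by
    rw [hrs, hrt]
    exact hc i
  -- The words `a'` and `b'` are kept free up to the equations `ha` and `hb`, so that they can be
  -- the labels of faces of cubes of `K` and `L`.
  refine ⟨p, q, f, g, s, t, hs, ht, hst, fun a' b' ha hb => ?_⟩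
  have hV : ∀ ε, c.1.2.onV ε = (f (ε ∘ s), g (ε ∘ t)) := fun ε =>
    Prod.ext ((funext (hh ε)).trans (hf ε).symm) ((funext (hh' ε)).trans (hg ε).symm)
  have hE := fun e => exists_fiberedProduct_edge_lift S f g ha hb (c.1.2.onE e)
    (v := (e (fun _ => false) ∘ s, e (fun _ => false) ∘ t))
    (w := (e (fun _ => true) ∘ s, e (fun _ => true) ∘ t))
    ((c.1.2.src_onE e).trans (hV _)) ((c.1.2.tgt_onE e).trans (hV _))
  choose E hE1 hE2 hE3 using hE
  refine ⟨⟨⟨c.1.1, ⟨fun ε => (ε ∘ s, ε ∘ t), E, hE2, hE3, fun e => ?_⟩⟩, fun _ => ?_⟩, fun _ => rfl,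
    syncCube_ext fun ε => (hV ε).symm⟩
  · have h1 := (fiberedProductMap S (cubeGraphMap f ha) (cubeGraphMap g hb)).lab_onE (E e)
    rw [hE1] at h1
    exact h1.symm.trans (c.1.2.lab_onE e)
  · refine (nonTwisted_iff _).2 ⟨Fin.append (fun j => Sum.inl (s j)) (fun j => Sum.inl (t j)),
      fun ε j => ?_, fun i => ?_⟩
    · refine Fin.addCases (fun j => ?_) (fun j => ?_) j
      · rw [Fin.append_left]
        exact Fin.append_left _ _ _
      · rw [Fin.append_right]
        exact Fin.append_right _ _ _
    · rcases hst i with ⟨j, rfl⟩ | ⟨j, rfl⟩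
      · exact ⟨Fin.castAdd q j, Fin.append_left _ _ _⟩
      · exact ⟨Fin.natAdd p j, Fin.append_right _ _ _⟩

end SyncCube

/-! ### Regularity of the synchronized tensor product. -/

section Tensor

variable {S : SyncLabels A} {K L : LSPS A}

/-- The two projections of a state of `K ⊗_Σ L`. -/
def tensorProj : (tensor S K L).cube 0 → K.cube 0 × L.cube 0 :=
  Quot.lift (fun z => (K.vtx z.1.1.2 (syncV z.2 fun i => i.elim0).1,
    L.vtx z.1.2.2 (syncV z.2 fun i => i.elim0).2)) (by
      rintro _ _ ⟨f, g, x, y, c⟩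
      exact Prod.ext (K.vtx_map f x _) (L.vtx_map g y _))

/-- A presentation of a cube `z` of `K ⊗_Σ L` by cubes `x` of `K` and `y` of `L` whose directions
are identified with directions of `z`. -/
structure TensorRep {k : ℕ} (z : (tensor S K L).cube k) where
  p : ℕ
  q : ℕ
  x : K.cube p
  y : L.cube q
  s : Fin p → Fin k
  t : Fin q → Fin k
  s_mono : StrictMono s
  t_mono : StrictMono t
  cover : ∀ i, i ∈ Set.range s ∨ i ∈ Set.range t
  c : (syncCube S (K.label x) (L.label y)).cube k
  syncV_c : ∀ ε, syncV c ε = (ε ∘ s, ε ∘ t)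
  mk_c : Quot.mk _ (preTensorMk S K L x y c) = z

/-- The lift of `exists_syncCube_lift` lives over the faces `f^* x` and `g^* y`, and the colimit
identifies it with the given cube. -/
theorem exists_tensorRep {k : ℕ} (z : (tensor S K L).cube k) : Nonempty (TensorRep z) := by
  obtain ⟨⟨⟨⟨m, x⟩, ⟨n, y⟩⟩, c⟩⟩ := z
  obtain ⟨p, q, f, g, s, t, hs, ht, hst, h⟩ := exists_syncCube_lift c
  obtain ⟨c', hc', rfl⟩ := h _ _ (K.label_map f x) (L.label_map g y)
  exact ⟨⟨p, q, K.map f x, L.map g y, s, t, hs, ht, hst, c', hc',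
    Quot.sound (TensorRel.mk f g x y c')⟩⟩

theorem TensorRep.tensorProj_vtx {k : ℕ} {z : (tensor S K L).cube k} (R : TensorRep z)
    (v : Vtx k) : tensorProj ((tensor S K L).vtx z v) =
      (K.vtx R.x (v ∘ R.s), L.vtx R.y (v ∘ R.t)) := by
  have h : tensorProj ((tensor S K L).vtx z v) =
      (K.vtx R.x (syncV R.c v).1, L.vtx R.y (syncV R.c v).2) := by
    conv_lhs => rw [← R.mk_c]
    rfl
  rw [h, R.syncV_c]

/-- The directions of a cube of a regular set are recovered from the vertices. -/
theorem Regular.mem_range_iff (hK : Regular K) {k p : ℕ} (x : K.cube p) {s : Fin p → Fin k}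
    (hs : Function.Injective s) (i : Fin k) : i ∈ Set.range s ↔
      K.vtx x ((fun _ => false) ∘ s) ≠ K.vtx x (Function.update (fun _ => false) i true ∘ s) := by
  constructor
  · rintro ⟨j, rfl⟩
    have h := hK.no_loop (K.map (BoxHom.axis j) x)
    rw [LSPS.source, LSPS.target, K.vtx_map, K.vtx_map, BoxHom.axis_false, BoxHom.axis_true] at h
    rwa [Function.update_comp_eq_of_injective _ hs]
  · intro h
    by_contra hi
    refine h (congrArg _ (funext fun j => ?_))
    rw [Function.comp_apply, Function.comp_apply,
      Function.update_of_ne fun e => hi ⟨j, e⟩]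

/-- The absence of loops recovers the range of `s`, monotonicity recovers `s` itself, and then the
vertices recover `x`. -/
theorem Regular.eq_of_projections (hK : Regular K) {k p p' : ℕ} (x : K.cube p) (x' : K.cube p')
    {s : Fin p → Fin k} {s' : Fin p' → Fin k} (hs : StrictMono s) (hs' : StrictMono s')
    (h : ∀ v : Vtx k, K.vtx x (v ∘ s) = K.vtx x' (v ∘ s')) :
    (⟨p, x, s⟩ : Σ p, K.cube p × (Fin p → Fin k)) = ⟨p', x', s'⟩ := by
  have hr : Set.range s = Set.range s' := Set.ext fun i => by
    rw [hK.mem_range_iff x hs.injective, hK.mem_range_iff x' hs'.injective, h, h]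
  obtain rfl : p = p' := by
    rw [← Nat.card_fin p, ← Nat.card_fin p', ← Nat.card_range_of_injective hs.injective,
      ← Nat.card_range_of_injective hs'.injective, hr]
  obtain rfl := (hs.range_inj hs').1 hr
  have hx : x = x' := hK.vertex_ext _ _ fun v => by
    -- As `s` is injective, every vertex of `x` is the projection of a vertex of the `k`-cube.
    have e := h (Function.extend s v fun _ => false)
    rwa [Function.extend_comp hs.injective] at e
  rw [hx]

/-- The projected vertices determine all the data of a presentation: the factors by
`Regular.eq_of_projections`, then the cube `c` by `syncCube_ext`. -/
theorem tensor_ext (hK : Regular K) (hL : Regular L) {k : ℕ} {z z' : (tensor S K L).cube k}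
    (h : ∀ v, tensorProj ((tensor S K L).vtx z v) = tensorProj ((tensor S K L).vtx z' v)) :
    z = z' := by
  obtain ⟨R⟩ := exists_tensorRep z
  obtain ⟨R'⟩ := exists_tensorRep z'
  have h' := fun v => (R.tensorProj_vtx v).symm.trans ((h v).trans (R'.tensorProj_vtx v))
  have e1 := hK.eq_of_projections R.x R'.x R.s_mono R'.s_mono fun v => congrArg Prod.fst (h' v)
  have e2 := hL.eq_of_projections R.y R'.y R.t_mono R'.t_mono fun v => congrArg Prod.snd (h' v)
  revert e1 e2
  obtain ⟨p, q, x, y, s, t, -, -, -, c, hc, rfl⟩ := R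
  obtain ⟨p', q', x', y', s', t', -, -, -, c', hc', rfl⟩ := R'
  intro e1 e2
  cases e1
  cases e2
  rw [syncCube_ext fun ε => (hc ε).trans (hc' ε).symm]

theorem tensorProj_injective (hK : Regular K) (hL : Regular L) :
    Function.Injective (tensorProj : (tensor S K L).cube 0 → _) := fun z z' h =>
  tensor_ext hK hL fun v => by rw [LSPS.vtx_zero, LSPS.vtx_zero, h]

section Events

variable {m n k : ℕ}

/-- The actions of `x` and of `y` along the direction `i` of a cube `c`. -/
def syncEvents (x : K.cube m) (y : L.cube n) (c : (syncCube S (K.label x) (L.label y)).cube k)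
    (i : Fin k) : Set (RAction K) × Set (RAction L) :=
  ({u | ∃ j, (syncV c fun _ => false).1 j ≠
      (syncV c (Function.update (fun _ => false) i true)).1 j ∧ u = rAction K x j},
    {u | ∃ j, (syncV c fun _ => false).2 j ≠
      (syncV c (Function.update (fun _ => false) i true)).2 j ∧ u = rAction L y j})

/-- This makes the events compatible with the identifications defining the tensor product:
coordinates outside the range of `f.dir` do not move. -/
theorem setOf_rAction_map {p : ℕ} (f : BoxHom p m) (x : K.cube m) (v w : Vtx p) :
    {u | ∃ j, v j ≠ w j ∧ u = rAction K (K.map f x) j} =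
      {u | ∃ j, f v j ≠ f w j ∧ u = rAction K x j} := by
  ext u
  constructor
  · rintro ⟨j, hj, rfl⟩
    exact ⟨f.dir j, by rwa [f.apply_dir, f.apply_dir], rAction_map f x j⟩
  · rintro ⟨j, hj, rfl⟩
    by_cases h : ∃ i, f.dir i = j
    · obtain ⟨i, rfl⟩ := h
      rw [f.apply_dir, f.apply_dir] at hj
      exact ⟨i, hj, (rAction_map f x i).symm⟩
    · have h' : ∀ i, f.dir i ≠ j := fun i hi => h ⟨i, hi⟩
      rw [f.apply_not_dir j h' v, f.apply_not_dir j h' w] at hj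
      exact absurd rfl hj

/-- Coordinates being constants or variables, parallel edges of `c` move the same ones. So the edge
may start at the source of `c` instead of the source of the face. -/
theorem syncEvents_map (x : K.cube m) (y : L.cube n)
    (c : (syncCube S (K.label x) (L.label y)).cube k) {l : ℕ} (f : BoxHom l k) (i : Fin l) :
    syncEvents x y ((syncCube S (K.label x) (L.label y)).map f c) i =
      syncEvents x y c (f.dir i) := by
  obtain ⟨h, g, hh, hg, -⟩ := syncV_exists_coord c
  have e : ∀ ε, syncV ((syncCube S (K.label x) (L.label y)).map f c) ε = syncV c (f ε) :=
    fun _ => rfl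
  simp only [syncEvents, e, f.dir_update i (fun _ => false) rfl, hh, hg,
    elim_update_ne_iff (f.dir_low i (fun _ => false) rfl),
    elim_update_ne_iff (ε := fun _ => false) (i := f.dir i) rfl]

/-- The actions of `K` and of `L` along a direction of a cube of `K ⊗_Σ L`. -/
def tensorEvents (z : (tensor S K L).cube k) (i : Fin k) : Set (RAction K) × Set (RAction L) :=
  Quot.lift (fun z : (preTensor S K L).cube k => syncEvents z.1.1.2 z.1.2.2 z.2 i) (by
    rintro _ _ ⟨f, g, x, y, c⟩
    exact Prod.ext (setOf_rAction_map f x _ _) (setOf_rAction_map g y _ _)) z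

theorem TensorRep.tensorEvents_eq {z : (tensor S K L).cube k} (R : TensorRep z) (i : Fin k) :
    tensorEvents z i = ({u | ∃ j, R.s j = i ∧ u = rAction K R.x j},
      {u | ∃ j, R.t j = i ∧ u = rAction L R.y j}) := by
  have h : tensorEvents z i = syncEvents R.x R.y R.c i := by
    conv_lhs => rw [← R.mk_c]
    rfl
  have e : ∀ l, false ≠ Function.update (fun _ : Fin k => false) i true l ↔ l = i := fun l => by
    by_cases hl : l = i
    · subst hl
      simp
    · simp [hl]
  simp only [h, syncEvents, R.syncV_c, Function.comp_apply, e]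

/-- An action of `x` at `j` occurs in the event of the direction `R.s j`, and so in an event of
`z'`. This reduces determinism of the tensor product to that of the factors. -/
theorem TensorRep.range_subset {k' : ℕ} {z : (tensor S K L).cube k} {z' : (tensor S K L).cube k'}
    (R : TensorRep z) (R' : TensorRep z')
    (h : Set.range (tensorEvents z) ⊆ Set.range (tensorEvents z')) :
    Set.range (rAction K R.x) ⊆ Set.range (rAction K R'.x) ∧
      Set.range (rAction L R.y) ⊆ Set.range (rAction L R'.y) := by
  constructor
  · rintro _ ⟨j, rfl⟩
    obtain ⟨i, hi⟩ := h ⟨R.s j, rfl⟩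
    rw [R.tensorEvents_eq, R'.tensorEvents_eq] at hi
    obtain ⟨j', -, e⟩ := (congrArg Prod.fst hi).ge ⟨j, rfl, rfl⟩
    exact ⟨j', e.symm⟩
  · rintro _ ⟨j, rfl⟩
    obtain ⟨i, hi⟩ := h ⟨R.t j, rfl⟩
    rw [R.tensorEvents_eq, R'.tensorEvents_eq] at hi
    obtain ⟨j', -, e⟩ := (congrArg Prod.snd hi).ge ⟨j, rfl, rfl⟩
    exact ⟨j', e.symm⟩

end Events

/-- An event is a pair of sets of actions, since a direction may move one factor or, for a
synchronization, both. Every direction moves at least one factor, and in that factor regularity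
excludes loops and separates the actions. -/
theorem Regular.tensor (hK : Regular K) (hL : Regular L) : Regular (tensor S K L) := by
  refine Regular.of_events (E := Set (RAction K) × Set (RAction L)) (fun z i => tensorEvents z i)
    ?_ ?_ ?_ ?_ ?_
  · rintro m n f ⟨⟨⟨⟨p, x⟩, ⟨q, y⟩⟩, c⟩⟩ i
    exact syncEvents_map x y c f i
  · intro n z z' h
    exact tensor_ext hK hL fun v => congrArg _ (h v)
  · intro z h
    obtain ⟨R⟩ := exists_tensorRep z
    have h' := congrArg tensorProj h
    rw [LSPS.source, LSPS.target, R.tensorProj_vtx, R.tensorProj_vtx] at h'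
    have e : (fun _ => true : Vtx 1) = Function.update (fun _ => false) 0 true := by
      funext i
      rw [Subsingleton.elim i 0, Function.update_self]
    rw [e] at h'
    rcases R.cover 0 with h0 | h0
    · exact (hK.mem_range_iff R.x R.s_mono.injective 0).1 h0 (congrArg Prod.fst h')
    · exact (hL.mem_range_iff R.y R.t_mono.injective 0).1 h0 (congrArg Prod.snd h')
  · intro n z i i' h
    obtain ⟨R⟩ := exists_tensorRep z
    beta_reduce at h
    rw [R.tensorEvents_eq, R.tensorEvents_eq] at h
    rcases R.cover i with ⟨j, hj⟩ | ⟨j, hj⟩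
    · obtain ⟨j', hj', e⟩ := (congrArg Prod.fst h).le ⟨j, hj, rfl⟩
      rw [← hj, ← hj', hK.action_injective R.x e]
    · obtain ⟨j', hj', e⟩ := (congrArg Prod.snd h).le ⟨j, hj, rfl⟩
      rw [← hj, ← hj', hL.action_injective R.y e]
  · intro m n z z' hs hr
    obtain ⟨R⟩ := exists_tensorRep z
    obtain ⟨R'⟩ := exists_tensorRep z'
    have h1 := R.range_subset R' hr.le
    have h2 := R'.range_subset R hr.ge
    have hs' := congrArg tensorProj hs
    rw [LSPS.source, LSPS.source, R.tensorProj_vtx, R'.tensorProj_vtx] at hs'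
    refine tensorProj_injective hK hL ?_
    rw [LSPS.target, LSPS.target, R.tensorProj_vtx, R'.tensorProj_vtx]
    exact Prod.ext (hK.det R.x R'.x (congrArg Prod.fst hs') (h1.1.antisymm h2.1))
      (hL.det R.y R'.y (congrArg Prod.snd hs') (h1.2.antisymm h2.2))

/-- States of the tensor product embed in pairs of states, on which the map acts componentwise. -/
theorem tensorMap_injective {K' L' : LSPS A} (hK : Regular K) (hL : Regular L)
    (φ : LSPS.Hom K K') (ψ : LSPS.Hom L L') (hφ : Function.Injective (φ.app (n := 0)))
    (hψ : Function.Injective (ψ.app (n := 0))) :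
    Function.Injective ((tensorMap S φ ψ).app (n := 0)) := by
  have h : ∀ z : (CCS.tensor S K L).cube 0,
      tensorProj ((tensorMap S φ ψ).app z) = Prod.map φ.app ψ.app (tensorProj z) := by
    rintro ⟨z⟩
    exact Prod.ext (φ.app_vtx _ _).symm (ψ.app_vtx _ _).symm
  intro z z' hz
  refine tensorProj_injective hK hL (hφ.prodMap hψ ?_)
  rw [← h, ← h, hz]

end Tensor

/-! ### Recursion and the induction on terms. -/

/-- A functor preserving regular sets and, between these, the maps which are injective on
states. -/
structure PreservesRegular {n : ℕ} (F : (Fin n → PLSPS A) ⥤ PLSPS A) : Prop where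
  obj : ∀ ρ, (∀ i, Regular (ρ i).toLSPS) → Regular (F.obj ρ).toLSPS
  map : ∀ {ρ ρ'} (g : ρ ⟶ ρ'), (∀ i, Regular (ρ i).toLSPS) → (∀ i, Regular (ρ' i).toLSPS) →
    (∀ i, Function.Injective ((g i).app (n := 0))) → Function.Injective ((F.map g).app (n := 0))

section Fix

variable {n : ℕ} {F : (Fin (n + 1) → PLSPS A) ⥤ PLSPS A}

theorem PreservesRegular.iter (hF : PreservesRegular F) {ρ : Fin n → PLSPS A}
    (hρ : ∀ i, Regular (ρ i).toLSPS) (k : ℕ) :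
    Regular (CCS.iter F ρ k).toLSPS := by
  induction k with
  | zero => exact regular_stdCube _
  | succ k ih => exact hF.obj _ fun i => Fin.cases ih hρ i

theorem PreservesRegular.iterStep (hF : PreservesRegular F) {ρ : Fin n → PLSPS A}
    (hρ : ∀ i, Regular (ρ i).toLSPS) (k : ℕ) :
    Function.Injective ((CCS.iterStep F ρ k).app (n := 0)) := by
  induction k with
  -- The interpretation of `nil` has a single state.
  | zero => exact fun x y _ => ULift.ext _ _ (boxHom_zero_unique _ _)
  | succ k ih =>
    exact hF.map _ (fun i => Fin.cases (hF.iter hρ k) hρ i)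
      (fun i => Fin.cases (hF.iter hρ (k + 1)) hρ i)
      (fun i => Fin.cases ih (fun _ _ _ h => h) i)

theorem PreservesRegular.iterMap (hF : PreservesRegular F)
    {ρ ρ' : Fin n → PLSPS A} (g : ρ ⟶ ρ')
    (hρ : ∀ i, Regular (ρ i).toLSPS) (hρ' : ∀ i, Regular (ρ' i).toLSPS)
    (hg : ∀ i, Function.Injective ((g i).app (n := 0))) (k : ℕ) :
    Function.Injective ((CCS.iterMap F g k).app (n := 0)) := by
  induction k with
  | zero => exact fun _ _ h => h
  | succ k ih =>
    exact hF.map _ (fun i => Fin.cases (hF.iter hρ k) hρ i)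
      (fun i => Fin.cases (hF.iter hρ' k) hρ' i) (fun i => Fin.cases ih hg i)

/-- The steps between the iterates are injective on states, which is what the colimit needs.
Injectivity in the parameters is carried along for the sake of nested recursions. -/
theorem PreservesRegular.fixFunctor (hF : PreservesRegular F) :
    PreservesRegular (CCS.fixFunctor F) where
  obj _ hρ := Regular.seqColim _ (hF.iter hρ) (hF.iterStep hρ)
  map g hρ hρ' hg := seqColimMap_injective _ (hF.iter hρ') (hF.iterStep hρ') _
    (iterStep_iterMap F g) (hF.iterMap g hρ hρ' hg)

end Fix

theorem Term.sem_preservesRegular {S : SyncLabels A} {n : ℕ} (P : Term S n) :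
    PreservesRegular P.sem := by
  induction P with
  | var i => exact ⟨fun _ h => h i, fun _ _ _ h => h i⟩
  | nil => exact ⟨fun _ _ => regular_stdCube _, fun _ _ _ _ _ _ h => h⟩
  | pre a P ih =>
    exact ⟨fun ρ h => (regular_stdCube _).glue (ih.obj ρ h), fun g h h' hg =>
      glueMap_injective _ _ rfl (P.sem.map g).app_base (fun _ _ h => h) (ih.map g h h' hg)⟩
  | nu a P ih =>
    exact ⟨fun ρ h => (ih.obj ρ h).sub _
      (fun f x hx i => by rw [LSPS.label_map]; exact hx (f.dir i)), fun g h h' hg _ _ e =>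
      Subtype.ext (ih.map g h h' hg (congrArg Subtype.val e))⟩
  | add P Q ihP ihQ =>
    exact ⟨fun ρ h => (ihP.obj ρ h).glue (ihQ.obj ρ h), fun g h h' hg =>
      glueMap_injective _ _ (P.sem.map g).app_base (Q.sem.map g).app_base
        (ihP.map g h h' hg) (ihQ.map g h h' hg)⟩
  | par P Q ihP ihQ =>
    exact ⟨fun ρ h => (ihP.obj ρ h).tensor (ihQ.obj ρ h), fun g h h' hg =>
      tensorMap_injective (ihP.obj _ h) (ihQ.obj _ h) _ _ (ihP.map g h h' hg) (ihQ.map g h h' hg)⟩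
  | fix P ih => exact ih.fixFunctor

theorem ProcName.regular {S : SyncLabels A} (P : ProcName S) : Regular P.interp.toLSPS :=
  P.1.sem_preservesRegular.obj _ fun i => i.elim0

end CCS

theorem mainTheorem4 {A : Type u} (S : CCS.SyncLabels A) (P : CCS.ProcName S) :
    CCS.HDAParadigm P.interp.toLSPS ∧
      (CCS.realization P.interp.toLSPS).CSA1 ∧
      (CCS.realization P.interp.toLSPS).UniqueIntermediateState ∧
      (CCS.realization P.interp.toLSPS).IsHDTS := by
  have h := P.regular.uniqueIntermediateState
  exact ⟨P.regular.hdaParadigm, P.regular.csa1, h, P.regular.csa1, h.csa2, h.csa3⟩
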